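/- Let $(a_k)_{k\ge 0}$ be a sequence in the unit disc $\mathbb D=\{|z|<1\}$, let $B_n(z)=\prod_{j=0}^{n-1}\frac{z-a_j}{1-z\overline{a_j}}$ ($B_0=1$), and let $\varphi_k(z)=\frac{\sqrt{1-|a_k|^2}}{1-z\overline{a_k}}B_k(z)$, $k\ge 0$, be the associated Takenaka--Malmquist system $\varphi$. Let $\mathcal S$ be the Schur class of holomorphic $f:\mathbb D\to\mathbb C$ with $\sup_{\mathbb D}|f|\le 1$; write $f$ also for its non-tangential boundary function on the unit circle $\mathbb T$ (defined a.e.). Let $A(\mathbb D)$ be the disc algebra of holomorphic functions on $\mathbb D$ that extend continuously to $\overline{\mathbb D}$. With $m$ the normalized Lebesgue measure on $\mathbb T$, put $\langle f,\varphi_k\rangle=\int_{\mathbb T}f\,\overline{\varphi_k}\,dm$, $S_n(f)=\sum_{k=0}^{n-1}\langle f,\varphi_k\rangle\varphi_k$ and, for $n\ge 1$, $$\sigma^+_{n,\varphi}(f)(z)=S_n(f)(z)-\frac{B_n(z)}{B_n'(z)}S_n(f)'(z),$$ at the points $z\in\overline{\mathbb D}$ with $B_n'(z)\neq 0$ (in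 particular on all of $\mathbb T$). Let $n\ge 1$. Then: (a) For every $z\in\mathbb D$ with $B_n'(z)\ne 0$, $$\left|\frac{B_n(z)}{B_n'(z)}\right|\frac{1-|B_n(z)|^2}{1-|z|^2}\le\sup_{f\in\mathcal S}\left|f(z)-\sigma^+_{n,\varphi}(f)(z)\right|\le\left|\frac{B_n(z)}{B_n'(z)}\right|\frac{1-|B_n(z)|^2}{1-|z|^2}+|B_n(z)|^2 .$$ (b) With norms taken on the unit circle, $$\sup_{f\in\mathcal S}\ \operatorname*{ess\,sup}_{t\in\mathbb T}\left|f(t)-\sigma^+_{n,\varphi}(f)(t)\right|=\sup_{f\in\mathcal S\cap A(\mathbb D)}\ \max_{t\in\mathbb T}\left|f(t)-\sigma^+_{n,\varphi}(f)(t)\right|=2 .$$ (c) If moreover $B_n/B_n'$ is holomorphic in $\mathbb D$ (after removal of removable singularities), then also, with norms taken in the disc and with the suprema over $z$ restricted to points where $B_n'(z)\neq0$, $$\sup_{f\in\mathcal S}\ \sup_{z\in\mathbb D}\left|f(z)-\sigma^+_{n,\varphi}(f)(z)\right|=\sup_{f\in\mathcal S\cap A(\mathbb D)}\ \sup_{z\in\overline{\mathbb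 D}}\left|f(z)-\sigma^+_{n,\varphi}(f)(z)\right|=2 .$$ -/

import Mathlib

open scoped ComplexConjugate ENNReal Topology

noncomputable section

namespace TakenakaMalmquist

/-- The finite Blaschke product `B_n(z) = ∏_{j<n} (z - a_j) / (1 - z * conj a_j)`; `B_0 = 1`. -/
def blaschke (a : ℕ → ℂ) (n : ℕ) (z : ℂ) : ℂ :=
  ∏ j ∈ Finset.range n, (z - a j) / (1 - z * conj (a j))

/-- The Takenaka–Malmquist function
`φ_k(z) = √(1 - |a_k|²) / (1 - z * conj a_k) * B_k(z)`. -/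
def phi (a : ℕ → ℂ) (k : ℕ) (z : ℂ) : ℂ :=
  ((Real.sqrt (1 - ‖a k‖ ^ 2) : ℝ) : ℂ) / (1 - z * conj (a k)) * blaschke a k z

/-- The filter of non-tangential approach to a point `t` of the unit circle from inside the
unit disc: convergence along it is convergence in every Stolz angle
`|t - z| < M (1 - |z|)` with vertex `t`. -/
def nonTangential (t : ℂ) : Filter ℂ :=
  ⨆ M : ℝ, 𝓝[{z : ℂ | ‖z‖ < 1 ∧ ‖t - z‖ < M * (1 - ‖z‖)}] t

/-- A function `f` on the open unit disc, prolonged to the unit circle by its non-tangential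
limits (which exist at almost every point of the circle when `f` is bounded and holomorphic). -/
def withBoundary (f : ℂ → ℂ) (z : ℂ) : ℂ :=
  open Classical in if ‖z‖ < 1 then f z else Filter.limUnder (nonTangential z) f

/-- The coefficient `⟨f, φ_k⟩ = ∫ f * conj φ_k dm` over the unit circle, where `m` is the
normalized Lebesgue measure and `f` stands on the circle for its boundary function. -/
def coeff (a : ℕ → ℂ) (f : ℂ → ℂ) (k : ℕ) : ℂ :=
  Real.circleAverage (fun t => withBoundary f t * conj (phi a k t)) 0 1

/-- The partial sum `S_n(f) = ∑_{k<n} ⟨f, φ_k⟩ φ_k`. -/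
def partialSum (a : ℕ → ℂ) (n : ℕ) (f : ℂ → ℂ) (z : ℂ) : ℂ :=
  ∑ k ∈ Finset.range n, coeff a f k * phi a k z

/-- The operator `σ⁺_{n,φ}`: `σ⁺_{0,φ}(f) = f` and, for `n ≥ 1`,
`σ⁺_{n,φ}(f) = S_n(f) - (B_n / B_n') S_n(f)'`. -/
def sigmaPlus (a : ℕ → ℂ) (n : ℕ) (f : ℂ → ℂ) (z : ℂ) : ℂ :=
  if n = 0 then withBoundary f z
  else partialSum a n f z
    - blaschke a n z / deriv (blaschke a n) z * deriv (partialSum a n f) z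

/-- The error function `f - σ⁺_{n,φ}(f)`, on the disc and on the circle. -/
def err (a : ℕ → ℂ) (n : ℕ) (f : ℂ → ℂ) (z : ℂ) : ℂ :=
  withBoundary f z - sigmaPlus a n f z

/-- The Schur class: holomorphic functions on the unit disc bounded by `1` there. -/
def schur : Set (ℂ → ℂ) :=
  {f | DifferentiableOn ℂ f (Metric.ball 0 1) ∧ ∀ z ∈ Metric.ball (0 : ℂ) 1, ‖f z‖ ≤ 1}

/-- The disc algebra: holomorphic functions on the unit disc with a continuous extension to the
closed unit disc. -/
def discAlgebra : Set (ℂ → ℂ) :=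
  {f | DifferentiableOn ℂ f (Metric.ball 0 1) ∧
    ∃ g : ℂ → ℂ, ContinuousOn g (Metric.closedBall 0 1) ∧ Set.EqOn f g (Metric.ball 0 1)}

/-- The norm of `L^∞(𝕋)`: the essential supremum of `|g|` over the unit circle,
parametrized by the angle. -/
def circleEssSup (g : ℂ → ℂ) : ℝ≥0∞ :=
  MeasureTheory.eLpNorm (fun θ : ℝ => g (circleMap 0 1 θ)) ∞
    (MeasureTheory.volume.restrict (Set.Ioc 0 (2 * Real.pi)))

/-- The supremum of `|g|` over a set. -/
def supOn (s : Set ℂ) (g : ℂ → ℂ) : ℝ≥0∞ := ⨆ z ∈ s, ‖g z‖ₑ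

end TakenakaMalmquist

end

section

open Metric Filter

namespace TakenakaMalmquist

/-! The proof turns on an exact formula for the error. Write `b = B_n(z)`, `β = B_n(w)`, `c =
B_n(z)/B_n'(z)`. The Christoffel–Darboux formula and its `z`-derivative show that `f(z) - σ⁺(f)(z)`
is the average over the circle of the boundary function of `f` against `c · w(1 - b conj β)/(w -
z)²`. Since `|β| = 1` there, `1 - b conj β = (1 - b conj β)(1 - conj b β) + conj b (β - b)`. The
first summand gives `errKernel`; the second is handled by Cauchy's formula and contributes `|b|²
f(z)` (`errKernel_identity`, `sub_sigmaPlus_eq`).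

The modulus of `errKernel` is `|1 - conj b β|²/|w - z|²`, whose mean is `(1 - |b|²)/(1 - |z|²)` by
Poisson's formula. This yields the upper estimate in (a). The Möbius map vanishing at `z` gives
equality for the integral term, because on the circle its argument is opposite to that of
`errKernel`, and it kills the term `|b|² f(z)`; this is the lower estimate.

On the circle `|B_n| = 1`, and `|B_n'|` equals the limit of `(1 - |B_n|²)/(1 - |z|²)`, so both terms
of the upper bound tend to `1` and the error is at most `2` wherever `f` has a non-tangential limit.
When `B_n/B_n'` is holomorphic, the maximum principle carries the bound `2` into the disc. The value
`2` is approached by functions of the disc algebra equal to `1` at `-1` whose coefficients tend to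
those of the constant `-1`: `σ⁺` reproduces constants, so their error at `-1` tends to `1 - (-1)`.

Boundary values rest on Fatou's theorem, proved here from the almost everywhere differentiability of
a Lipschitz primitive along the circle. -/

/-! ### Non-tangential approach and boundary values -/

/-- Radial approach is non-tangential. -/
lemma tendsto_radial {t : ℂ} (ht : ‖t‖ = 1) :
    Tendsto (fun r : ℝ => (r : ℂ) * t) (𝓝[<] 1) (nonTangential t) := by
  -- On the radius `|t - z| = 1 - |z|`, so any aperture above `1` works.
  have hle : 𝓝[{z : ℂ | ‖z‖ < 1 ∧ ‖t - z‖ < 2 * (1 - ‖z‖)}] t ≤ nonTangential t :=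
    le_iSup (fun M : ℝ => 𝓝[{z : ℂ | ‖z‖ < 1 ∧ ‖t - z‖ < M * (1 - ‖z‖)}] t) 2
  refine Tendsto.mono_right ?_ hle
  refine tendsto_nhdsWithin_iff.2 ⟨?_, ?_⟩
  · have : Tendsto (fun r : ℝ => (r : ℂ) * t) (𝓝 1) (𝓝 (((1 : ℝ) : ℂ) * t)) :=
      (Continuous.tendsto (by fun_prop) 1)
    simp only [Complex.ofReal_one, one_mul] at this
    exact this.mono_left nhdsWithin_le_nhds
  · have h0 : ∀ᶠ r : ℝ in 𝓝[<] 1, 0 < r := nhdsWithin_le_nhds (lt_mem_nhds one_pos)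
    filter_upwards [h0, self_mem_nhdsWithin] with r hr0 hr1
    have hr1 : r < 1 := hr1
    have h1 : ‖(r : ℂ) * t‖ = r := by simp [ht, abs_of_pos hr0]
    have h2 : ‖t - (r : ℂ) * t‖ = 1 - r := by
      have : t - (r : ℂ) * t = ((1 - r : ℝ) : ℂ) * t := by push_cast; ring
      rw [this, norm_mul, ht, mul_one, Complex.norm_real, Real.norm_of_nonneg (by linarith)]
    refine ⟨by rw [h1]; exact hr1, ?_⟩
    rw [h1, h2]
    linarith

lemma nonTangential_neBot {t : ℂ} (ht : ‖t‖ = 1) : (nonTangential t).NeBot :=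
  (tendsto_radial ht).neBot

lemma nonTangential_le (t : ℂ) : nonTangential t ≤ 𝓝[ball 0 1] t :=
  iSup_le fun _ => nhdsWithin_mono _ fun z hz => by simpa using hz.1

lemma withBoundary_of_norm_lt {f : ℂ → ℂ} {z : ℂ} (hz : ‖z‖ < 1) : withBoundary f z = f z := by
  simp [withBoundary, hz]

lemma withBoundary_of_tendsto {f : ℂ → ℂ} {t L : ℂ} (ht : ‖t‖ = 1)
    (h : Tendsto f (nonTangential t) (𝓝 L)) : withBoundary f t = L := by
  have := nonTangential_neBot ht
  simp only [withBoundary, ht, lt_irrefl, if_false]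
  exact h.limUnder_eq

lemma one_sub_mul_conj_ne_zero {z w : ℂ} (hz : ‖z‖ ≤ 1) (hw : ‖w‖ < 1) : 1 - z * conj w ≠ 0 := by
  intro h
  have h1 : ‖z * conj w‖ = 1 := by rw [← sub_eq_zero.1 h]; simp
  rw [norm_mul, RCLike.norm_conj] at h1
  nlinarith [norm_nonneg z, norm_nonneg w]

/-! ### Fatou's theorem -/

lemma diffContOnCl_dslope {h : ℂ → ℂ} (hh : DiffContOnCl ℂ h (ball 0 1)) {z : ℂ} (hz : ‖z‖ < 1) :
    DiffContOnCl ℂ (dslope h z) (ball 0 1) := by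
  have hcl : closure (ball (0 : ℂ) 1) = closedBall 0 1 := closure_ball _ one_ne_zero
  have hnhds : ball (0 : ℂ) 1 ∈ 𝓝 z := isOpen_ball.mem_nhds (by simpa using hz)
  refine ⟨(Complex.differentiableOn_dslope hnhds).2 hh.1, ?_⟩
  rw [hcl]
  exact (continuousOn_dslope (mem_of_superset hnhds ball_subset_closedBall)).2
    ⟨by rw [← hcl]; exact hh.2, hh.1.differentiableAt hnhds⟩

/-- The derivative of a function as an average of its boundary values against a real-variable type
kernel. -/
lemma deriv_eq_circleAverage {R : ℂ → ℂ} (hR : DiffContOnCl ℂ R (ball 0 1)) {z : ℂ}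
    (hz : ‖z‖ < 1) :
    deriv R z = Real.circleAverage
      (fun w => (w / (w - z) ^ 2 - w * conj z ^ 2 / (1 - w * conj z) ^ 2) * R w) 0 1 := by
  have hzb : z ∈ ball (0 : ℂ) |1| := by simpa using hz
  have hcl : closure (ball (0 : ℂ) 1) = closedBall 0 1 := closure_ball _ one_ne_zero
  have hden : ∀ w ∈ closedBall (0 : ℂ) 1, 1 - w * conj z ≠ 0 := fun w hw =>
    one_sub_mul_conj_ne_zero (by simpa using hw) hz
  have hne : ∀ w ∈ sphere (0 : ℂ) |1|, w - z ≠ 0 := by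
    intro w hw h
    have : ‖w‖ = 1 := by simpa using hw
    rw [sub_eq_zero.1 h] at this
    linarith
  have hcR : ContinuousOn R (closedBall 0 1) := by rw [← hcl]; exact hR.2
  have hds : DiffContOnCl ℂ (dslope R z) (ball 0 |1|) := by
    rw [abs_one]
    exact diffContOnCl_dslope hR hz
  have e1 := hds.circleAverage_smul_div hzb
  rw [dslope_same] at e1
  -- The subtracted part of the kernel is holomorphic in `w` and vanishes at `0`, so its product
  -- with `R` has mean zero; it is there only to make the kernel smaller.
  have hg : DiffContOnCl ℂ (fun w => w * conj z ^ 2 / (1 - w * conj z) ^ 2 * R w) (ball 0 |1|) := by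
    rw [abs_one]
    refine ⟨DifferentiableOn.mul (DifferentiableOn.div (by fun_prop) (by fun_prop) ?_) hR.1, ?_⟩
    · exact fun w hw => pow_ne_zero 2 (hden w (ball_subset_closedBall hw))
    · rw [hcl]
      refine ContinuousOn.mul (ContinuousOn.div (by fun_prop) (by fun_prop) ?_) hcR
      exact fun w hw => pow_ne_zero 2 (hden w hw)
  have e2 := hg.circleAverage
  have e3 : Real.circleAverage (fun w => w / (w - z) ^ 2) 0 1 = 0 := by
    rw [Real.circleAverage_eq_circleIntegral one_ne_zero]
    have : (∮ w in C(0, 1), (w - 0)⁻¹ • (w / (w - z) ^ 2)) = ∮ w in C(0, 1), (w - z) ^ (-2 : ℤ) := by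
      refine circleIntegral.integral_congr zero_le_one fun w hw => ?_
      have hw0 : w ≠ 0 := by rintro rfl; simp at hw
      simp only [sub_zero, smul_eq_mul, zpow_neg]
      have := hne w (by simpa using hw)
      norm_cast
      field_simp
    rw [this, circleIntegral.integral_sub_zpow_of_ne (by norm_num), smul_zero]
  have c1 : CircleIntegrable (fun w => w / (w - z) * dslope R z w) 0 1 := by
    refine ContinuousOn.circleIntegrable zero_le_one ?_
    refine ContinuousOn.mul (ContinuousOn.div (by fun_prop) (by fun_prop) ?_) ?_
    · exact fun w hw => hne w (by simpa using hw)
    · refine hds.2.mono ?_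
      rw [abs_one, hcl]
      exact sphere_subset_closedBall
  have c2 : CircleIntegrable (fun w => w * conj z ^ 2 / (1 - w * conj z) ^ 2 * R w) 0 1 := by
    refine ContinuousOn.circleIntegrable zero_le_one (hg.2.mono ?_)
    rw [abs_one, hcl]
    exact sphere_subset_closedBall
  have c3 : CircleIntegrable (fun w => R z * (w / (w - z) ^ 2)) 0 1 := by
    refine ContinuousOn.circleIntegrable zero_le_one ?_
    refine ContinuousOn.mul (by fun_prop) (ContinuousOn.div (by fun_prop) (by fun_prop) ?_)
    exact fun w hw => pow_ne_zero 2 (hne w (by simpa using hw))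
  have key : Set.EqOn
      (fun w => (w / (w - z) ^ 2 - w * conj z ^ 2 / (1 - w * conj z) ^ 2) * R w)
      (fun w => (w / (w - z) * dslope R z w + R z * (w / (w - z) ^ 2)) -
        w * conj z ^ 2 / (1 - w * conj z) ^ 2 * R w) (sphere 0 |1|) := by
    intro w hw
    have h := hne w hw
    have hwz : w ≠ z := fun h' => h (sub_eq_zero.2 h')
    simp only [dslope_of_ne _ hwz, slope_def_field]
    field_simp
    ring
  have c13 : CircleIntegrable
      (fun w => w / (w - z) * dslope R z w + R z * (w / (w - z) ^ 2)) 0 1 := c1.add c3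
  rw [Real.circleAverage_congr_sphere key, Real.circleAverage_fun_sub c13 c2,
    Real.circleAverage_fun_add c1 c3]
  have e4 : Real.circleAverage (fun w => R z * (w / (w - z) ^ 2)) 0 1 = 0 := by
    have := Real.circleAverage_fun_smul (a := R z) (f := fun w => w / (w - z) ^ 2) (c := 0) (R := 1)
    simp only [smul_eq_mul] at this
    rw [this, e3, mul_zero]
  simp only [smul_eq_mul, sub_zero] at e1
  rw [e1, e4, e2]
  simp

/-- The numerator is a difference of squares: one factor equals `1 - |z|²`, the other is at most
`2|w - z|` because `|1 - w conj z| = |w - z|` on the circle. The Cauchy kernel `1/|w - z|²` alone,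
tested against `ε|w - t|`, would lose a logarithm; this bound leaves `ε` times a Poisson kernel. -/
lemma norm_kernel_le {z w : ℂ} (hz : ‖z‖ < 1) (hw : ‖w‖ = 1) :
    ‖w / (w - z) ^ 2 - w * conj z ^ 2 / (1 - w * conj z) ^ 2‖ ≤ 2 * (1 - ‖z‖ ^ 2) / ‖w - z‖ ^ 3 := by
  have hwz : w - z ≠ 0 := by
    intro h
    rw [sub_eq_zero.1 h] at hw
    linarith
  have hww : w * conj w = 1 := by rw [Complex.mul_conj']; simp [hw]
  have hw0 : w ≠ 0 := by rintro rfl; simp at hw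
  have h1 : 1 - w * conj z = w * conj (w - z) := by rw [map_sub, mul_sub, hww]
  have hc : conj (w - z) ≠ 0 := (map_ne_zero _).2 hwz
  have hn : ‖1 - w * conj z‖ = ‖w - z‖ := by rw [h1, norm_mul, hw, one_mul, RCLike.norm_conj]
  have h1' : 1 - w * conj z ≠ 0 := by rw [h1]; exact mul_ne_zero hw0 hc
  have e : w / (w - z) ^ 2 - w * conj z ^ 2 / (1 - w * conj z) ^ 2 =
      w * ((1 - w * conj z) + conj z * (w - z)) * ((1 - w * conj z) - conj z * (w - z)) /
        ((w - z) ^ 2 * (1 - w * conj z) ^ 2) := by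
    field_simp
    ring
  have e2 : (1 - w * conj z) + conj z * (w - z) = ((1 - ‖z‖ ^ 2 : ℝ) : ℂ) := by
    push_cast
    rw [← Complex.mul_conj']
    ring
  have hz2 : 0 ≤ 1 - ‖z‖ ^ 2 := by nlinarith [norm_nonneg z]
  have hpos : 0 < ‖w - z‖ := norm_pos_iff.2 hwz
  rw [e, e2, norm_div, norm_mul, norm_mul, norm_mul, norm_pow, norm_pow, hn, hw,
    Complex.norm_real, Real.norm_of_nonneg hz2, one_mul]
  have h3 : ‖(1 - w * conj z) - conj z * (w - z)‖ ≤ 2 * ‖w - z‖ := by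
    refine (norm_sub_le _ _).trans ?_
    rw [hn, norm_mul, RCLike.norm_conj]
    nlinarith
  rw [div_le_div_iff₀ (by positivity) (by positivity)]
  have := mul_le_mul_of_nonneg_left h3 hz2
  have h4 : 0 ≤ ‖w - z‖ ^ 3 := by positivity
  nlinarith [mul_le_mul_of_nonneg_right this h4]

lemma ofReal_circleAverage {g : ℂ → ℝ} :
    ((Real.circleAverage g 0 1 : ℝ) : ℂ) = Real.circleAverage (fun w => (g w : ℂ)) 0 1 := by
  simp only [Real.circleAverage, intervalIntegral.integral_ofReal, Complex.real_smul, smul_eq_mul]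
  push_cast
  rfl

lemma circleAverage_mul_poisson {h : ℂ → ℂ} (hh : DiffContOnCl ℂ h (ball 0 1)) {z : ℂ}
    (hz : ‖z‖ < 1) :
    Real.circleAverage (fun w => h w * ((1 / ‖w - z‖ ^ 2 : ℝ) : ℂ)) 0 1
      = h z / ((1 - ‖z‖ ^ 2 : ℝ) : ℂ) := by
  have hz2 : 1 - ‖z‖ ^ 2 ≠ 0 := by nlinarith [norm_nonneg z]
  have hP := hh.circleAverage_poissonKernel_smul' (w := z) (by simpa using hz)
  rw [Real.circleAverage_congr_sphere (f₂ := fun w => ((1 - ‖z‖ ^ 2 : ℝ) : ℂ) •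
    (h w * ((1 / ‖w - z‖ ^ 2 : ℝ) : ℂ))), Real.circleAverage_fun_smul, smul_eq_mul] at hP
  · rw [← hP, mul_div_cancel_left₀ _ (by exact_mod_cast hz2)]
  · intro w hw
    have hw : ‖w‖ = 1 := by simpa using hw
    simp only [sub_zero, hw, Complex.real_smul, smul_eq_mul]
    push_cast
    ring

lemma circleAverage_poisson {z : ℂ} (hz : ‖z‖ < 1) :
    Real.circleAverage (fun w => 1 / ‖w - z‖ ^ 2) 0 1 = 1 / (1 - ‖z‖ ^ 2) := by
  have h := circleAverage_mul_poisson (h := fun _ => 1) diffContOnCl_const hz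
  simp only [one_mul] at h
  rw [← ofReal_circleAverage] at h
  exact_mod_cast h

lemma norm_circleAverage_le {f : ℂ → ℂ} {g : ℂ → ℝ} (hg : CircleIntegrable g 0 1)
    (h : ∀ᵐ θ : ℝ, ‖f (circleMap 0 1 θ)‖ ≤ g (circleMap 0 1 θ)) :
    ‖Real.circleAverage f 0 1‖ ≤ Real.circleAverage g 0 1 := by
  rw [Real.circleAverage, Real.circleAverage, norm_smul, smul_eq_mul,
    Real.norm_of_nonneg (by positivity)]
  refine mul_le_mul_of_nonneg_left ?_ (by positivity)
  refine intervalIntegral.norm_integral_le_of_norm_le (by positivity) ?_ hg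
  filter_upwards [h] with θ hθ _ using hθ

/-- If the boundary function of a primitive is differentiable along the circle at a point, then the
error of its linear approximation is small near that point of the circle. -/
lemma eventually_norm_sub_linear_le {G : ℂ → ℂ} {θ₀ : ℝ} {D : ℂ}
    (hD : HasDerivAt (fun θ : ℝ => G (circleMap 0 1 θ)) D θ₀) {ε : ℝ} (hε : 0 < ε) :
    ∀ᶠ w in 𝓝 (circleMap 0 1 θ₀), ‖w‖ = 1 →
      ‖G w - G (circleMap 0 1 θ₀) - D / (circleMap 0 1 θ₀ * Complex.I) * (w - circleMap 0 1 θ₀)‖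
        ≤ ε * ‖w - circleMap 0 1 θ₀‖ := by
  set t := circleMap 0 1 θ₀ with ht
  have ht0 : t ≠ 0 := circleMap_ne_center one_ne_zero
  have htn : ‖t‖ = 1 := by simp [ht]
  have htI : t * Complex.I ≠ 0 := mul_ne_zero ht0 Complex.I_ne_zero
  have hγ : HasDerivAt (circleMap 0 1) (t * Complex.I) θ₀ := hasDerivAt_circleMap 0 1 θ₀
  have hR : HasDerivAt (fun θ : ℝ => G (circleMap 0 1 θ) - G t -
      D / (t * Complex.I) * (circleMap 0 1 θ - t)) 0 θ₀ := by
    have := (hD.sub_const (G t)).sub ((hγ.sub_const t).const_mul (D / (t * Complex.I)))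
    rwa [div_mul_cancel₀ _ htI, sub_self] at this
  have ho := hR.isLittleO
  simp only [smul_zero, sub_zero, ← ht, sub_self, mul_zero] at ho
  -- The parametrization has nonzero derivative, so an error `o(θ - θ₀)` is also `o(w - t)`.
  have hO : (fun θ : ℝ => θ - θ₀) =O[𝓝 θ₀] fun θ => circleMap 0 1 θ - t :=
    (HasDerivAtFilter.isTheta_sub hγ htI).isBigO_symm.comp_tendsto
      (k := fun θ : ℝ => (θ, θ₀)) (tendsto_id.prodMk
        (tendsto_pure.2 (Eventually.of_forall fun _ => rfl)))
  have hev := (ho.trans_isBigO hO).bound hε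
  -- A continuous local inverse of the parametrization near `t`.
  have hcont : Tendsto (fun w : ℂ => θ₀ + Complex.arg (w / t)) (𝓝 t) (𝓝 θ₀) := by
    have : ContinuousAt (fun w : ℂ => θ₀ + Complex.arg (w / t)) t := by
      refine continuousAt_const.add (ContinuousAt.comp (g := Complex.arg) ?_ (by fun_prop))
      rw [div_self ht0]
      exact Complex.continuousAt_arg Complex.one_mem_slitPlane
    simpa [ContinuousAt, div_self ht0] using this
  filter_upwards [hcont.eventually hev] with w hw hwn
  have hwt : circleMap 0 1 (θ₀ + Complex.arg (w / t)) = w := by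
    have h1 := Complex.norm_mul_exp_arg_mul_I (w / t)
    rw [norm_div, hwn, htn, div_one, Complex.ofReal_one, one_mul] at h1
    have h2 : circleMap 0 1 (θ₀ + Complex.arg (w / t)) =
        t * Complex.exp (Complex.arg (w / t) * Complex.I) := by
      simp [circleMap, ht, add_mul, Complex.exp_add]
    rw [h2, h1, mul_div_cancel₀ _ ht0]
  simpa only [hwt] using hw

lemma circleIntegrable_poisson {z : ℂ} (hz : ‖z‖ < 1) :
    CircleIntegrable (fun w => 1 / ‖w - z‖ ^ 2) 0 1 := by
  refine ContinuousOn.circleIntegrable zero_le_one ?_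
  refine ContinuousOn.div (by fun_prop) (by fun_prop) fun w hw h => ?_
  have hw' : ‖w‖ = 1 := by simpa using hw
  have : w - z = 0 := by simpa using h
  rw [sub_eq_zero.1 this] at hw'
  linarith

/-- A holomorphic function bounded by a linear-plus-cubic modulus at a boundary point has small
derivative in every Stolz angle. -/
lemma norm_deriv_le_of_boundary_le {R : ℂ → ℂ} (hR : DiffContOnCl ℂ R (ball 0 1)) {t z : ℂ}
    {ε C M : ℝ} (hε : 0 ≤ ε) (hC : 0 ≤ C) (hM : 0 ≤ M) (hz : ‖z‖ < 1)
    (hzt : ‖t - z‖ < M * (1 - ‖z‖))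
    (hb : ∀ w, ‖w‖ = 1 → ‖R w‖ ≤ ε * ‖w - t‖ + C * ‖w - t‖ ^ 3) :
    ‖deriv R z‖ ≤ 2 * ε * (1 + M) + 2 * C * (1 + M) ^ 3 * (1 - ‖z‖ ^ 2) := by
  have hz2 : 0 < 1 - ‖z‖ ^ 2 := by nlinarith [norm_nonneg z]
  have hint := (circleIntegrable_poisson hz)
  have hi1 : CircleIntegrable
      (fun w => 2 * ε * (1 + M) * (1 - ‖z‖ ^ 2) * (1 / ‖w - z‖ ^ 2)) 0 1 := by
    simpa only [smul_eq_mul] using hint.const_fun_smul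
      (a := 2 * ε * (1 + M) * (1 - ‖z‖ ^ 2))
  have hi2 : CircleIntegrable (fun _ => 2 * C * (1 + M) ^ 3 * (1 - ‖z‖ ^ 2)) 0 1 :=
    circleIntegrable_const _ _ _
  rw [deriv_eq_circleAverage hR hz]
  refine (norm_circleAverage_le (g := fun w =>
    2 * ε * (1 + M) * (1 - ‖z‖ ^ 2) * (1 / ‖w - z‖ ^ 2) + 2 * C * (1 + M) ^ 3 * (1 - ‖z‖ ^ 2))
    (hi1.add hi2) (Eventually.of_forall fun θ => ?_)).trans (le_of_eq ?_)
  · have hw : ‖circleMap 0 1 θ‖ = 1 := by simp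
    generalize circleMap 0 1 θ = w at hw
    have hwz : 1 - ‖z‖ ≤ ‖w - z‖ := by
      have := norm_sub_norm_le w z
      linarith
    have hpos : 0 < ‖w - z‖ := by linarith
    have hwt : ‖w - t‖ ≤ (1 + M) * ‖w - z‖ := by
      have h1 : ‖w - t‖ ≤ ‖w - z‖ + ‖t - z‖ := by
        have := norm_sub_le (w - z) (t - z)
        rwa [sub_sub_sub_cancel_right] at this
      nlinarith
    rw [norm_mul]
    have hRw : ‖R w‖ ≤ ε * ((1 + M) * ‖w - z‖) + C * ((1 + M) * ‖w - z‖) ^ 3 := by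
      refine (hb w hw).trans ?_
      gcongr
    refine (mul_le_mul (norm_kernel_le hz hw) hRw (norm_nonneg _) (by positivity)).trans
      (le_of_eq ?_)
    field_simp
  · rw [Real.circleAverage_fun_add hi1 hi2, Real.circleAverage_const]
    have := Real.circleAverage_fun_smul (a := 2 * ε * (1 + M) * (1 - ‖z‖ ^ 2))
      (f := fun w : ℂ => 1 / ‖w - z‖ ^ 2) (c := 0) (R := 1)
    simp only [smul_eq_mul] at this
    rw [this, circleAverage_poisson hz]
    field_simp

/-- If the boundary function of a primitive of `f` is differentiable along the circle at a point,
then `f` has a non-tangential limit there. -/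
lemma tendsto_nonTangential_of_hasDerivAt {f G : ℂ → ℂ} (hG : ContinuousOn G (closedBall 0 1))
    (hd : ∀ z ∈ ball (0 : ℂ) 1, HasDerivAt G (f z) z) {θ₀ : ℝ} {D : ℂ}
    (hD : HasDerivAt (fun θ : ℝ => G (circleMap 0 1 θ)) D θ₀) :
    Tendsto f (nonTangential (circleMap 0 1 θ₀)) (𝓝 (D / (circleMap 0 1 θ₀ * Complex.I))) := by
  have hev := fun (ε : ℝ) (hε : 0 < ε) => eventually_norm_sub_linear_le hD hε
  have htn : ‖circleMap 0 1 θ₀‖ = 1 := by simp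
  generalize circleMap 0 1 θ₀ = t at hev htn ⊢
  set c := D / (t * Complex.I)
  set R : ℂ → ℂ := fun w => G w - G t - c * (w - t) with hRdef
  have hcl : closure (ball (0 : ℂ) 1) = closedBall 0 1 := closure_ball _ one_ne_zero
  have hRd : ∀ z ∈ ball (0 : ℂ) 1, HasDerivAt R (f z - c) z := fun z hz => by
    have := ((hd z hz).sub_const (G t)).sub (((hasDerivAt_id z).sub_const t).const_mul c)
    rwa [mul_one] at this
  have hRc : ContinuousOn R (closedBall 0 1) := by
    refine (hG.sub continuousOn_const).sub (by fun_prop)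
  have hR : DiffContOnCl ℂ R (ball 0 1) :=
    ⟨fun z hz => (hRd z hz).differentiableAt.differentiableWithinAt, by rwa [hcl]⟩
  obtain ⟨C₀, hC₀⟩ := (isCompact_sphere (0 : ℂ) 1).exists_bound_of_continuousOn
    (hRc.mono sphere_subset_closedBall)
  refine tendsto_iSup.2 fun M => ?_
  rw [tendsto_iff_norm_sub_tendsto_zero]
  refine (nhdsWithin_basis_ball.tendsto_iff nhds_basis_ball).2 fun δ hδ => ?_
  set N := max M 0
  have hN : 0 ≤ N := le_max_right _ _
  set ε := δ / (8 * (1 + N)) with hε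
  have hεpos : 0 < ε := by positivity
  obtain ⟨η, hη, hnear⟩ := Metric.eventually_nhds_iff.1 (hev ε hεpos)
  -- Near `t` differentiability gives the linear term. Elsewhere `|w - t| ≥ η`, and the bound for
  -- `R` is absorbed by a cubic term; the cube cancels the cube in the kernel estimate and leaves a
  -- factor `1 - |z|²` that tends to zero.
  have hb : ∀ w, ‖w‖ = 1 → ‖R w‖ ≤ ε * ‖w - t‖ + (|C₀| / η ^ 3) * ‖w - t‖ ^ 3 := by
    intro w hw
    by_cases h : ‖w - t‖ < η
    · have := hnear (by rwa [dist_eq_norm]) hw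
      have h2 : 0 ≤ (|C₀| / η ^ 3) * ‖w - t‖ ^ 3 := by positivity
      exact this.trans (by linarith)
    · have h1 : ‖R w‖ ≤ |C₀| := (hC₀ w (by simpa using hw)).trans (le_abs_self _)
      have h2 : |C₀| ≤ (|C₀| / η ^ 3) * ‖w - t‖ ^ 3 := by
        rw [div_mul_eq_mul_div, le_div_iff₀ (by positivity)]
        gcongr
        exact not_lt.1 h
      have h3 : 0 ≤ ε * ‖w - t‖ := by positivity
      linarith
  set C := |C₀| / η ^ 3
  have hC : 0 ≤ C := by positivity
  refine ⟨δ / (8 * (C * (1 + N) ^ 3 + 1)), by positivity, ?_⟩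
  rintro z ⟨hzt, hz1, hzM⟩
  have hzt : ‖z - t‖ < δ / (8 * (C * (1 + N) ^ 3 + 1)) := by simpa [dist_eq_norm] using hzt
  have hzM' : ‖t - z‖ < N * (1 - ‖z‖) := by
    refine hzM.trans_le ?_
    have : M ≤ N := le_max_left _ _
    nlinarith
  have hmain := norm_deriv_le_of_boundary_le hR hεpos.le hC hN hz1 hzM' hb
  rw [(hRd z (by simpa using hz1)).deriv] at hmain
  have h1 : 2 * ε * (1 + N) = δ / 4 := by rw [hε]; field_simp; norm_num
  have h2 : 1 - ‖z‖ ^ 2 ≤ 2 * ‖z - t‖ := by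
    have := norm_sub_norm_le t z
    rw [norm_sub_rev, htn] at this
    nlinarith [norm_nonneg z]
  have h3 : 2 * C * (1 + N) ^ 3 * (1 - ‖z‖ ^ 2) ≤ δ / 2 := by
    rw [lt_div_iff₀ (by positivity)] at hzt
    have : 0 ≤ C * (1 + N) ^ 3 := by positivity
    nlinarith [mul_le_mul_of_nonneg_left h2 this, norm_nonneg (z - t)]
  simp only [mem_ball, dist_zero_right, Real.norm_eq_abs, abs_norm]
  linarith

/-- **Fatou's theorem** for bounded holomorphic functions on the unit disc. -/
theorem ae_exists_tendsto_nonTangential {f : ℂ → ℂ} (hf : f ∈ schur) :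
    ∀ᵐ θ : ℝ, ∃ L : ℂ, Tendsto f (nonTangential (circleMap 0 1 θ)) (𝓝 L) := by
  -- Since `|f| ≤ 1`, a primitive is `1`-Lipschitz. It extends to a Lipschitz function on the plane,
  -- whose restriction to the circle is differentiable almost everywhere.
  obtain ⟨F, hF⟩ := hf.1.isExactOn_ball
  have hlip : LipschitzOnWith 1 F (ball 0 1) :=
    (convex_ball (0 : ℂ) 1).lipschitzOnWith_of_nnnorm_hasDerivWithin_le
      (fun z hz => (hF z hz).hasDerivWithinAt) fun z hz => by exact_mod_cast hf.2 z hz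
  obtain ⟨G, hG, hFG⟩ := hlip.extend_finite_dimension
  have hd : ∀ z ∈ ball (0 : ℂ) 1, HasDerivAt G (f z) z := fun z hz =>
    (hF z hz).congr_of_eventuallyEq
      (mem_of_superset (isOpen_ball.mem_nhds hz) fun w hw => (hFG hw).symm)
  have hlip2 := hG.comp (lipschitzWith_circleMap 0 1)
  filter_upwards [hlip2.ae_differentiableAt_real] with θ hθ
  exact ⟨_, tendsto_nonTangential_of_hasDerivAt hG.continuous.continuousOn hd hθ.hasDerivAt⟩

/-! ### Boundary functions and Cauchy's formula -/

lemma ae_tendsto_radial {f : ℂ → ℂ} (hf : f ∈ schur) :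
    ∀ᵐ θ : ℝ, Tendsto (fun r : ℝ => f (r * circleMap 0 1 θ)) (𝓝[<] 1)
      (𝓝 (withBoundary f (circleMap 0 1 θ))) := by
  filter_upwards [ae_exists_tendsto_nonTangential hf] with θ ⟨L, hL⟩
  have ht : ‖circleMap 0 1 θ‖ = 1 := by simp
  rw [withBoundary_of_tendsto ht hL]
  exact hL.comp (tendsto_radial ht)

lemma exists_radii : ∃ u : ℕ → ℝ, (∀ n, 0 < u n ∧ u n < 1) ∧ Tendsto u atTop (𝓝[<] 1) := by
  obtain ⟨u, -, hu, hlim⟩ := exists_seq_strictMono_tendsto' (zero_lt_one' ℝ)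
  exact ⟨u, hu, tendsto_nhdsWithin_iff.2 ⟨hlim, Eventually.of_forall fun n => (hu n).2⟩⟩

lemma norm_ofReal_mul_lt {r : ℝ} (h0 : 0 < r) (h1 : r < 1) {w : ℂ} (hw : ‖w‖ ≤ 1) :
    ‖(r : ℂ) * w‖ < 1 := by
  rw [norm_mul, Complex.norm_real, Real.norm_of_nonneg h0.le]
  nlinarith [norm_nonneg w]

lemma diffContOnCl_dilation {f : ℂ → ℂ} (hf : DifferentiableOn ℂ f (ball 0 1)) {r : ℝ}
    (h0 : 0 < r) (h1 : r < 1) : DiffContOnCl ℂ (fun w => f (r * w)) (ball 0 1) := by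
  have hcl : closure (ball (0 : ℂ) 1) = closedBall 0 1 := closure_ball _ one_ne_zero
  refine DifferentiableOn.diffContOnCl ?_
  rw [hcl]
  refine hf.comp (by fun_prop) fun w hw => ?_
  simpa using norm_ofReal_mul_lt h0 h1 (by simpa using hw)

lemma continuousOn_circle_comp {h : ℂ → ℂ} (hh : ContinuousOn h (sphere 0 1)) :
    Continuous fun θ : ℝ => h (circleMap 0 1 θ) :=
  hh.comp_continuous (continuous_circleMap 0 1) fun θ => by simp

lemma aestronglyMeasurable_withBoundary {f : ℂ → ℂ} (hf : f ∈ schur) :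
    MeasureTheory.AEStronglyMeasurable (fun θ : ℝ => withBoundary f (circleMap 0 1 θ)) := by
  obtain ⟨u, hu, hlim⟩ := exists_radii
  refine aestronglyMeasurable_of_tendsto_ae atTop
    (f := fun n θ => f (u n * circleMap 0 1 θ)) (fun n => ?_) ?_
  · refine (continuousOn_circle_comp (h := fun w => f (u n * w)) ?_).aestronglyMeasurable
    refine (diffContOnCl_dilation hf.1 (hu n).1 (hu n).2).2.mono ?_
    rw [closure_ball _ one_ne_zero]
    exact sphere_subset_closedBall
  · filter_upwards [ae_tendsto_radial hf] with θ hθ using hθ.comp hlim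

lemma ae_norm_withBoundary_le {f : ℂ → ℂ} (hf : f ∈ schur) :
    ∀ᵐ θ : ℝ, ‖withBoundary f (circleMap 0 1 θ)‖ ≤ 1 := by
  filter_upwards [ae_tendsto_radial hf] with θ hθ
  refine le_of_tendsto hθ.norm ?_
  have h0 : ∀ᶠ r : ℝ in 𝓝[<] 1, 0 < r := nhdsWithin_le_nhds (lt_mem_nhds one_pos)
  filter_upwards [h0, self_mem_nhdsWithin] with r hr0 hr1
  exact hf.2 _ (by simpa using norm_ofReal_mul_lt hr0 hr1 (w := circleMap 0 1 θ) (by simp))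

lemma circleIntegrable_withBoundary_mul {f h : ℂ → ℂ} (hf : f ∈ schur)
    (hh : ContinuousOn h (sphere 0 1)) :
    CircleIntegrable (fun w => withBoundary f w * h w) 0 1 := by
  have hc := continuousOn_circle_comp hh
  have hi : IntervalIntegrable (fun θ : ℝ => h (circleMap 0 1 θ)) MeasureTheory.volume 0
    (2 * Real.pi) := hc.intervalIntegrable _ _
  refine hi.mono_fun ?_ ?_
  · exact ((aestronglyMeasurable_withBoundary hf).mul hc.aestronglyMeasurable).restrict
  · refine MeasureTheory.ae_restrict_of_ae ?_
    filter_upwards [ae_norm_withBoundary_le hf] with θ hθ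
    rw [norm_mul]
    exact mul_le_of_le_one_left (norm_nonneg _) hθ

/-- The Cauchy formula in terms of the boundary function of a bounded holomorphic function. -/
theorem circleAverage_withBoundary_cauchy {f h : ℂ → ℂ} (hf : f ∈ schur)
    (hh : DiffContOnCl ℂ h (ball 0 1)) {z : ℂ} (hz : ‖z‖ < 1) :
    Real.circleAverage (fun w => withBoundary f w * (h w * (w / (w - z)))) 0 1 = f z * h z := by
  obtain ⟨u, hu, hlim⟩ := exists_radii
  have hcl : closure (ball (0 : ℂ) 1) = closedBall 0 1 := closure_ball _ one_ne_zero
  have hk : ContinuousOn (fun w => h w * (w / (w - z))) (sphere 0 1) := by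
    refine ContinuousOn.mul (hh.2.mono (by rw [hcl]; exact sphere_subset_closedBall))
      (ContinuousOn.div (by fun_prop) (by fun_prop) fun w hw h => ?_)
    have hw' : ‖w‖ = 1 := by simpa using hw
    rw [sub_eq_zero.1 h] at hw'
    linarith
  have hkc := continuousOn_circle_comp hk
  -- Dilations of `f` are continuous up to the circle, so the classical formula applies; dominated
  -- convergence then lets the radii tend to `1`.
  have hn : ∀ n, Real.circleAverage (fun w => f (u n * w) * (h w * (w / (w - z)))) 0 1
      = f (u n * z) * h z := by
    intro n
    have hd : DiffContOnCl ℂ (fun w => f (u n * w) * h w) (ball 0 1) :=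
      (diffContOnCl_dilation hf.1 (hu n).1 (hu n).2).smul hh
    have := DiffContOnCl.circleAverage_smul_div (R := 1) (c := 0) (w := z) (by rwa [abs_one])
      (by simpa using hz)
    rw [← this]
    refine congrArg (fun g => Real.circleAverage g 0 1) (funext fun w => ?_)
    simp only [smul_eq_mul, sub_zero]
    ring
  have hlim1 : Tendsto (fun n => f (u n * z) * h z) atTop (𝓝 (f z * h z)) := by
    have hfc : ContinuousAt f z := (hf.1.differentiableAt
      (isOpen_ball.mem_nhds (by simpa using hz))).continuousAt
    have hu1 : Tendsto (fun n => (u n : ℂ) * z) atTop (𝓝 z) := by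
      have h1 : Tendsto u atTop (𝓝 1) := hlim.mono_right nhdsWithin_le_nhds
      have := ((Complex.continuous_ofReal.tendsto 1).comp h1).mul_const z
      simpa using this
    exact (hfc.tendsto.comp hu1).mul_const _
  refine tendsto_nhds_unique ?_ hlim1
  simp only [← hn, Real.circleAverage]
  refine Tendsto.const_smul ?_ _
  refine intervalIntegral.tendsto_integral_filter_of_dominated_convergence
    (fun θ => ‖h (circleMap 0 1 θ) * (circleMap 0 1 θ / (circleMap 0 1 θ - z))‖)
    (Eventually.of_forall fun n => ?_) (Eventually.of_forall fun n => ?_) ?_ ?_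
  · refine ((continuousOn_circle_comp (h := fun w => f (u n * w)) ?_).mul
      hkc).aestronglyMeasurable
    refine (diffContOnCl_dilation hf.1 (hu n).1 (hu n).2).2.mono ?_
    rw [hcl]
    exact sphere_subset_closedBall
  · refine Eventually.of_forall fun θ _ => ?_
    rw [norm_mul]
    refine mul_le_of_le_one_left (norm_nonneg _) (hf.2 _ ?_)
    simpa using norm_ofReal_mul_lt (hu n).1 (hu n).2 (w := circleMap 0 1 θ) (by simp)
  · exact hkc.norm.intervalIntegrable _ _
  · filter_upwards [ae_tendsto_radial hf] with θ hθ _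
    exact (hθ.comp hlim).mul_const _

/-! ### The reproducing kernel and Christoffel–Darboux -/

lemma mul_conj_of_norm_one {w : ℂ} (hw : ‖w‖ = 1) : w * conj w = 1 := by
  rw [Complex.mul_conj']; simp [hw]

lemma one_sub_mul_conj_of_norm_one (z : ℂ) {w : ℂ} (hw : ‖w‖ = 1) :
    1 - z * conj w = (w - z) * conj w := by
  rw [sub_mul, mul_conj_of_norm_one hw]

/-- The reproducing kernel of the span of `φ_0, …, φ_{n-1}`. -/
noncomputable def kernel (a : ℕ → ℂ) (n : ℕ) (z w : ℂ) : ℂ :=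
  ∑ k ∈ Finset.range n, phi a k z * conj (phi a k w)

/-- The derivative of `kernel` in its first variable. -/
noncomputable def kernelDeriv (a : ℕ → ℂ) (n : ℕ) (z w : ℂ) : ℂ :=
  ∑ k ∈ Finset.range n, deriv (phi a k) z * conj (phi a k w)

lemma kernel_self (a : ℕ → ℂ) (n : ℕ) (z : ℂ) :
    kernel a n z z = ((∑ k ∈ Finset.range n, ‖phi a k z‖ ^ 2 : ℝ) : ℂ) := by
  simp [kernel, Complex.mul_conj']

variable {a : ℕ → ℂ} {f : ℂ → ℂ}

/-- The **Christoffel–Darboux formula** for the Takenaka–Malmquist system. -/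
theorem christoffel_darboux (ha : ∀ k, ‖a k‖ < 1) (n : ℕ) {z w : ℂ}
    (hz : ∀ k ∈ Finset.range n, 1 - z * conj (a k) ≠ 0)
    (hw : ∀ k ∈ Finset.range n, 1 - w * conj (a k) ≠ 0) :
    (1 - z * conj w) * kernel a n z w = 1 - blaschke a n z * conj (blaschke a n w) := by
  induction n with
  | zero => simp [kernel, blaschke]
  | succ n ih =>
    have ih := ih (fun k hk => hz k (Finset.mem_range.2 (by have := Finset.mem_range.1 hk; omega)))
      (fun k hk => hw k (Finset.mem_range.2 (by have := Finset.mem_range.1 hk; omega)))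
    have hzn := hz n (by simp)
    have hwn : 1 - conj w * a n ≠ 0 := by
      have := (map_ne_zero (starRingEnd ℂ)).2 (hw n (by simp))
      simpa using this
    have hs : ((Real.sqrt (1 - ‖a n‖ ^ 2) : ℝ) : ℂ) * ((Real.sqrt (1 - ‖a n‖ ^ 2) : ℝ) : ℂ)
        = 1 - a n * conj (a n) := by
      rw [← Complex.ofReal_mul, Real.mul_self_sqrt, Complex.mul_conj']
      · push_cast; ring
      · nlinarith [ha n, norm_nonneg (a n)]
    rw [kernel, Finset.sum_range_succ, mul_add]
    rw [kernel] at ih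
    rw [ih, phi, phi]
    simp only [blaschke, Finset.prod_range_succ, map_mul, map_div₀, map_sub, map_one,
      Complex.conj_conj, Complex.conj_ofReal]
    set P := ∏ j ∈ Finset.range n, (z - a j) / (1 - z * conj (a j))
    set Q := conj (∏ j ∈ Finset.range n, (w - a j) / (1 - w * conj (a j)))
    set s := ((Real.sqrt (1 - ‖a n‖ ^ 2) : ℝ) : ℂ)
    have e : (1 - z * conj w) * (s / (1 - z * conj (a n)) * P * (s / (1 - conj w * a n) * Q)) =
        (1 - z * conj w) * (s * s) * P * Q / ((1 - z * conj (a n)) * (1 - conj w * a n)) := by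
      field_simp
    -- The induction step is `(1 - z conj w)(1 - |a|²) + (z - a)(conj w - conj a) = (1 - z conj a)(1
    -- - a conj w)` with `a = a n`.
    rw [e, hs]
    field_simp
    ring

lemma differentiableAt_blaschke (ha : ∀ k, ‖a k‖ < 1) (n : ℕ) {z : ℂ} (hz : ‖z‖ ≤ 1) :
    DifferentiableAt ℂ (blaschke a n) z := by
  unfold blaschke
  refine DifferentiableAt.fun_finsetProd fun k _ => ?_
  exact DifferentiableAt.div (by fun_prop) (by fun_prop) (one_sub_mul_conj_ne_zero hz (ha k))

lemma differentiableAt_phi (ha : ∀ k, ‖a k‖ < 1) (k : ℕ) {z : ℂ} (hz : ‖z‖ ≤ 1) :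
    DifferentiableAt ℂ (phi a k) z := by
  unfold phi
  refine DifferentiableAt.mul (DifferentiableAt.div (by fun_prop) (by fun_prop)
    (one_sub_mul_conj_ne_zero hz (ha k))) (differentiableAt_blaschke ha k hz)

lemma continuousOn_blaschke (ha : ∀ k, ‖a k‖ < 1) (n : ℕ) :
    ContinuousOn (blaschke a n) (closedBall 0 1) := fun z hz =>
  (differentiableAt_blaschke ha n (by simpa using hz)).continuousAt.continuousWithinAt

lemma continuousOn_phi (ha : ∀ k, ‖a k‖ < 1) (n : ℕ) :
    ContinuousOn (phi a n) (closedBall 0 1) := fun z hz =>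
  (differentiableAt_phi ha n (by simpa using hz)).continuousAt.continuousWithinAt

lemma diffContOnCl_blaschke (ha : ∀ k, ‖a k‖ < 1) (n : ℕ) :
    DiffContOnCl ℂ (blaschke a n) (ball 0 1) :=
  ⟨fun _ hz => (differentiableAt_blaschke ha n
    (by simpa using (ball_subset_closedBall hz))).differentiableWithinAt,
    by rw [closure_ball _ one_ne_zero]; exact continuousOn_blaschke ha n⟩

lemma christoffel_darboux' (ha : ∀ k, ‖a k‖ < 1) (n : ℕ) {z w : ℂ} (hz : ‖z‖ ≤ 1) (hw : ‖w‖ ≤ 1) :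
    (1 - z * conj w) * kernel a n z w = 1 - blaschke a n z * conj (blaschke a n w) :=
  christoffel_darboux ha n (fun k _ => one_sub_mul_conj_ne_zero hz (ha k))
    (fun k _ => one_sub_mul_conj_ne_zero hw (ha k))

/-- The Christoffel–Darboux formula, differentiated in its first variable. -/
lemma christoffel_darboux_deriv (ha : ∀ k, ‖a k‖ < 1) (n : ℕ) {z w : ℂ} (hz : ‖z‖ ≤ 1)
    (hw : ‖w‖ ≤ 1) :
    (1 - z * conj w) * kernelDeriv a n z w - conj w * kernel a n z w
      = - (deriv (blaschke a n) z * conj (blaschke a n w)) := by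
  have hK : HasDerivAt (fun z => kernel a n z w) (kernelDeriv a n z w) z := by
    refine HasDerivAt.fun_sum fun k _ => ?_
    exact (differentiableAt_phi ha k hz).hasDerivAt.mul_const _
  have h1 : HasDerivAt (fun z => (1 - z * conj w) * kernel a n z w)
      (-(1 * conj w) * kernel a n z w + (1 - z * conj w) * kernelDeriv a n z w) z :=
    (((hasDerivAt_id z).mul_const (conj w)).const_sub 1).mul hK
  have h2 : HasDerivAt (fun z => 1 - blaschke a n z * conj (blaschke a n w))
      (-(deriv (blaschke a n) z * conj (blaschke a n w))) z :=
    ((differentiableAt_blaschke ha n hz).hasDerivAt.mul_const _).const_sub 1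
  -- For `|z| = 1` the identity is needed on a full neighbourhood of `z`, beyond the closed disc;
  -- hence `christoffel_darboux` asks only that the denominators do not vanish.
  have hev : (fun z => (1 - z * conj w) * kernel a n z w) =ᶠ[𝓝 z]
      fun z => 1 - blaschke a n z * conj (blaschke a n w) := by
    have : ∀ᶠ y in 𝓝 z, ∀ k ∈ Finset.range n, 1 - y * conj (a k) ≠ 0 := by
      refine (Finset.eventually_all _).2 fun k _ => ?_
      have hc : ContinuousAt (fun y => 1 - y * conj (a k)) z := by fun_prop
      exact hc.eventually_ne (one_sub_mul_conj_ne_zero hz (ha k))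
    filter_upwards [this] with y hy
    exact christoffel_darboux ha n hy fun k _ => one_sub_mul_conj_ne_zero hw (ha k)
  have := h1.unique (h2.congr_of_eventuallyEq hev)
  rw [← this]
  ring

lemma norm_blaschke_of_norm_one (ha : ∀ k, ‖a k‖ < 1) (n : ℕ) {t : ℂ} (ht : ‖t‖ = 1) :
    ‖blaschke a n t‖ = 1 := by
  have h := christoffel_darboux' ha n ht.le ht.le
  rw [mul_conj_of_norm_one ht, sub_self, zero_mul, Complex.mul_conj'] at h
  have h' : ‖blaschke a n t‖ ^ 2 = 1 := by exact_mod_cast (sub_eq_zero.1 h.symm).symm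
  nlinarith [norm_nonneg (blaschke a n t)]

/-- The energy `∑_{k<n} |φ_k(z)|²`, the diagonal of the reproducing kernel. -/
noncomputable def energy (a : ℕ → ℂ) (n : ℕ) (z : ℂ) : ℝ := ∑ k ∈ Finset.range n, ‖phi a k z‖ ^ 2

lemma energy_eq (ha : ∀ k, ‖a k‖ < 1) (n : ℕ) {z : ℂ} (hz : ‖z‖ < 1) :
    (1 - ‖blaschke a n z‖ ^ 2) / (1 - ‖z‖ ^ 2) = energy a n z := by
  have h := christoffel_darboux' ha n hz.le hz.le
  rw [Complex.mul_conj', Complex.mul_conj', kernel_self] at h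
  have h' : (1 - ‖z‖ ^ 2) * energy a n z = 1 - ‖blaschke a n z‖ ^ 2 := by
    unfold energy
    exact_mod_cast h
  have : 1 - ‖z‖ ^ 2 ≠ 0 := by nlinarith [norm_nonneg z]
  rw [← h']
  field_simp

/-- On the diagonal of the circle the factor `1 - z conj w` vanishes, and the differentiated
Christoffel–Darboux formula reduces to `conj t · K(t,t) = B_n'(t) conj B_n(t)`. -/
lemma norm_deriv_blaschke_of_norm_one (ha : ∀ k, ‖a k‖ < 1) (n : ℕ) {t : ℂ} (ht : ‖t‖ = 1) :
    ‖deriv (blaschke a n) t‖ = energy a n t := by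
  have h := christoffel_darboux_deriv ha n ht.le ht.le
  rw [mul_conj_of_norm_one ht, sub_self, zero_mul, zero_sub, neg_inj, kernel_self] at h
  have := congrArg norm h
  rw [norm_mul, norm_mul, RCLike.norm_conj, RCLike.norm_conj, ht, one_mul,
    norm_blaschke_of_norm_one ha n ht, mul_one, Complex.norm_real, Real.norm_of_nonneg] at this
  · exact this.symm
  · positivity

lemma energy_pos (ha : ∀ k, ‖a k‖ < 1) {n : ℕ} (hn : 1 ≤ n) {t : ℂ} (ht : ‖t‖ ≤ 1) :
    0 < energy a n t := by
  have h0 : 0 < ‖phi a 0 t‖ ^ 2 := by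
    have hs : 0 < Real.sqrt (1 - ‖a 0‖ ^ 2) :=
      Real.sqrt_pos.2 (by nlinarith [ha 0, norm_nonneg (a 0)])
    have : phi a 0 t ≠ 0 := by
      simp only [phi, blaschke, Finset.range_zero, Finset.prod_empty, mul_one]
      exact div_ne_zero (by exact_mod_cast hs.ne') (one_sub_mul_conj_ne_zero ht (ha 0))
    positivity
  exact h0.trans_le (Finset.single_le_sum (f := fun k => ‖phi a k t‖ ^ 2)
    (fun k _ => by positivity) (Finset.mem_range.2 hn))

lemma deriv_blaschke_ne_zero (ha : ∀ k, ‖a k‖ < 1) {n : ℕ} (hn : 1 ≤ n) {t : ℂ} (ht : ‖t‖ = 1) :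
    deriv (blaschke a n) t ≠ 0 := by
  rw [← norm_pos_iff, norm_deriv_blaschke_of_norm_one ha n ht]
  exact energy_pos ha hn ht.le

/-! ### The error formula and the pointwise estimate -/

lemma pairing_add (hf : f ∈ schur) {g h : ℂ → ℂ} (hg : ContinuousOn g (sphere 0 1))
    (hh : ContinuousOn h (sphere 0 1)) :
    Real.circleAverage (fun w => withBoundary f w * (g w + h w)) 0 1 =
      Real.circleAverage (fun w => withBoundary f w * g w) 0 1 +
      Real.circleAverage (fun w => withBoundary f w * h w) 0 1 := by
  rw [← Real.circleAverage_fun_add (circleIntegrable_withBoundary_mul hf hg)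
    (circleIntegrable_withBoundary_mul hf hh)]
  simp only [mul_add]

lemma pairing_const_mul (c : ℂ) (g : ℂ → ℂ) :
    Real.circleAverage (fun w => withBoundary f w * (c * g w)) 0 1 =
      c * Real.circleAverage (fun w => withBoundary f w * g w) 0 1 := by
  rw [← smul_eq_mul, ← Real.circleAverage_fun_smul]
  simp only [smul_eq_mul, mul_left_comm]

lemma sum_coeff_mul (ha : ∀ k, ‖a k‖ < 1) (hf : f ∈ schur) (n : ℕ) (c : ℕ → ℂ) :
    ∑ k ∈ Finset.range n, coeff a f k * c k =
      Real.circleAverage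
        (fun w => withBoundary f w * ∑ k ∈ Finset.range n, c k * conj (phi a k w)) 0 1 := by
  have hc : ∀ k, ContinuousOn (fun w => conj (phi a k w)) (sphere 0 1) := fun k =>
    Complex.continuous_conj.comp_continuousOn
      ((continuousOn_phi ha k).mono sphere_subset_closedBall)
  simp only [Finset.mul_sum]
  rw [Real.circleAverage_fun_sum
    (f := fun k w => withBoundary f w * (c k * conj (phi a k w))) fun k _ =>
    circleIntegrable_withBoundary_mul hf (continuousOn_const.mul (hc k))]
  refine Finset.sum_congr rfl fun k _ => ?_
  rw [pairing_const_mul, coeff, mul_comm]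

lemma deriv_partialSum (ha : ∀ k, ‖a k‖ < 1) (n : ℕ) {z : ℂ} (hz : ‖z‖ ≤ 1) :
    deriv (partialSum a n f) z = ∑ k ∈ Finset.range n, coeff a f k * deriv (phi a k) z := by
  have : HasDerivAt (partialSum a n f)
      (∑ k ∈ Finset.range n, coeff a f k * deriv (phi a k) z) z :=
    HasDerivAt.fun_sum fun k _ => (differentiableAt_phi ha k hz).hasDerivAt.const_mul _
  exact this.deriv

lemma partialSum_eq (ha : ∀ k, ‖a k‖ < 1) (hf : f ∈ schur) (n : ℕ) (z : ℂ) :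
    partialSum a n f z =
      Real.circleAverage (fun w => withBoundary f w * kernel a n z w) 0 1 :=
  sum_coeff_mul ha hf n _

lemma deriv_partialSum_eq (ha : ∀ k, ‖a k‖ < 1) (hf : f ∈ schur) (n : ℕ) {z : ℂ} (hz : ‖z‖ ≤ 1) :
    deriv (partialSum a n f) z =
      Real.circleAverage (fun w => withBoundary f w * kernelDeriv a n z w) 0 1 := by
  rw [deriv_partialSum ha n hz, sum_coeff_mul ha hf n]
  rfl

lemma sub_ne_zero_of_norm {z w : ℂ} (hz : ‖z‖ < 1) (hw : ‖w‖ = 1) : w - z ≠ 0 := by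
  intro h
  rw [sub_eq_zero.1 h] at hw
  linarith

/-- The kernel of the error functional at `z`, positive up to a unimodular factor. -/
noncomputable def errKernel (a : ℕ → ℂ) (n : ℕ) (z w : ℂ) : ℂ :=
  w / (w - z) ^ 2 * ((1 - blaschke a n z * conj (blaschke a n w)) *
    (1 - conj (blaschke a n z) * blaschke a n w))

/-- By Christoffel–Darboux and its derivative the left side collapses to `c w (1 - b conj β)/(w -
z)²`. Splitting off `conj b (β - b)`, possible since `|β| = 1`, leaves a kernel whose phase no
longer depends on `B_n`. -/
lemma errKernel_identity (ha : ∀ k, ‖a k‖ < 1) (n : ℕ) {z w : ℂ} (hz : ‖z‖ < 1)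
    (hd : deriv (blaschke a n) z ≠ 0) (hw : ‖w‖ = 1) :
    w / (w - z) + (-1) * kernel a n z w +
      blaschke a n z / deriv (blaschke a n) z * kernelDeriv a n z w =
    blaschke a n z / deriv (blaschke a n) z *
      (errKernel a n z w +
        conj (blaschke a n z) * (dslope (blaschke a n) z w * (w / (w - z)))) := by
  have hwz := sub_ne_zero_of_norm hz hw
  have hne : w ≠ z := sub_ne_zero.1 hwz
  have hw1 := mul_conj_of_norm_one hw
  have hw0 : w ≠ 0 := left_ne_zero_of_mul_eq_one hw1
  have hcw : conj w = 1 / w := by rw [eq_div_iff hw0, mul_comm, hw1]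
  have hB := mul_conj_of_norm_one (norm_blaschke_of_norm_one ha n hw)
  have h1 := christoffel_darboux' ha n hz.le hw.le
  have h2 := christoffel_darboux_deriv ha n hz.le hw.le
  rw [one_sub_mul_conj_of_norm_one z hw, hcw] at h1 h2
  rw [dslope_of_ne _ hne, slope_def_field, errKernel]
  set b := blaschke a n z
  set b' := deriv (blaschke a n) z
  set β := blaschke a n w
  have hK : kernel a n z w = (1 - b * conj β) * w / (w - z) := by
    rw [← h1]; field_simp
  have hK' : kernelDeriv a n z w = (kernel a n z w / w - b' * conj β) * w / (w - z) := by
    have : (w - z) * (1 / w) * kernelDeriv a n z w = kernel a n z w / w - b' * conj β := by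
      linear_combination h2
    rw [← this]; field_simp
  rw [hK', hK]
  field_simp
  linear_combination -(b ^ 2 * conj b) * hB

lemma continuousOn_errKernel (ha : ∀ k, ‖a k‖ < 1) (n : ℕ) {z : ℂ} (hz : ‖z‖ < 1) :
    ContinuousOn (errKernel a n z) (sphere 0 1) := by
  have hB := (continuousOn_blaschke ha n).mono sphere_subset_closedBall
  have hBc : ContinuousOn (fun w => conj (blaschke a n w)) (sphere 0 1) :=
    Complex.continuous_conj.comp_continuousOn hB
  refine ContinuousOn.mul (ContinuousOn.div (by fun_prop) (by fun_prop) fun w hw => ?_)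
    ((continuousOn_const.sub (continuousOn_const.mul hBc)).mul
      (continuousOn_const.sub (continuousOn_const.mul hB)))
  exact pow_ne_zero 2 (sub_ne_zero_of_norm hz (by simpa using hw))

lemma sub_sigmaPlus_eq (ha : ∀ k, ‖a k‖ < 1) (hf : f ∈ schur) {n : ℕ} (hn : 1 ≤ n) {z : ℂ}
    (hz : ‖z‖ < 1) (hd : deriv (blaschke a n) z ≠ 0) :
    f z - sigmaPlus a n f z = blaschke a n z / deriv (blaschke a n) z *
      (Real.circleAverage (fun w => withBoundary f w * errKernel a n z w) 0 1 +
        conj (blaschke a n z) * (f z * deriv (blaschke a n) z)) := by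
  have hcl : closure (ball (0 : ℂ) 1) = closedBall 0 1 := closure_ball _ one_ne_zero
  have hn0 : n ≠ 0 := by omega
  have hds := diffContOnCl_dslope (diffContOnCl_blaschke ha n) hz
  have e1 := circleAverage_withBoundary_cauchy hf (h := fun _ => 1) diffContOnCl_const hz
  have e4 := circleAverage_withBoundary_cauchy hf hds hz
  rw [dslope_same] at e4
  simp only [one_mul, mul_one] at e1
  have hq : ContinuousOn (fun w : ℂ => w / (w - z)) (sphere 0 1) :=
    ContinuousOn.div (by fun_prop) (by fun_prop) fun w hw =>
      sub_ne_zero_of_norm hz (by simpa using hw)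
  have hc : ∀ k, ContinuousOn (fun w => conj (phi a k w)) (sphere 0 1) := fun k =>
    Complex.continuous_conj.comp_continuousOn
      ((continuousOn_phi ha k).mono sphere_subset_closedBall)
  have hK : ContinuousOn (kernel a n z) (sphere 0 1) :=
    continuousOn_finsetSum _ fun k _ => continuousOn_const.mul (hc k)
  have hK' : ContinuousOn (kernelDeriv a n z) (sphere 0 1) :=
    continuousOn_finsetSum _ fun k _ => continuousOn_const.mul (hc k)
  have hE := continuousOn_errKernel ha n hz
  have hS : ContinuousOn (fun w => dslope (blaschke a n) z w * (w / (w - z))) (sphere 0 1) :=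
    (hds.2.mono (by rw [hcl]; exact sphere_subset_closedBall)).mul hq
  rw [sigmaPlus, if_neg hn0, partialSum_eq ha hf, deriv_partialSum_eq ha hf n hz.le, ← e4]
  nth_rewrite 1 [← e1]
  set c := blaschke a n z / deriv (blaschke a n) z
  have h1 := pairing_add hf (g := fun w => w / (w - z) + (-1) * kernel a n z w)
    (h := fun w => c * kernelDeriv a n z w) (hq.add (continuousOn_const.mul hK))
    (continuousOn_const.mul hK')
  have h2 := pairing_add hf (h := fun w => (-1) * kernel a n z w) hq (continuousOn_const.mul hK)
  have h3 := pairing_add hf (h := fun w => conj (blaschke a n z) *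
    (dslope (blaschke a n) z w * (w / (w - z)))) hE (continuousOn_const.mul hS)
  rw [h2, pairing_const_mul, pairing_const_mul] at h1
  rw [pairing_const_mul] at h3
  have h4 : Real.circleAverage (fun w => withBoundary f w *
      ((w / (w - z) + (-1) * kernel a n z w) + c * kernelDeriv a n z w)) 0 1 =
      Real.circleAverage (fun w => withBoundary f w * (c * (errKernel a n z w +
        conj (blaschke a n z) * (dslope (blaschke a n) z w * (w / (w - z)))))) 0 1 := by
    refine Real.circleAverage_congr_sphere fun w hw => ?_
    have hw : ‖w‖ = 1 := by simpa using hw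
    simp only [errKernel_identity ha n hz hd hw, c]
  rw [h1, pairing_const_mul c, h3] at h4
  linear_combination h4

lemma norm_errKernel (a : ℕ → ℂ) (n : ℕ) {z w : ℂ} (hw : ‖w‖ = 1) :
    ‖errKernel a n z w‖ =
      ‖1 - conj (blaschke a n z) * blaschke a n w‖ ^ 2 * (1 / ‖w - z‖ ^ 2) := by
  have h : 1 - blaschke a n z * conj (blaschke a n w) =
      conj (1 - conj (blaschke a n z) * blaschke a n w) := by simp
  rw [errKernel, norm_mul, norm_mul, norm_div, norm_pow, hw, h, RCLike.norm_conj]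
  ring

/-- The total mass of the error kernel. -/
lemma circleAverage_norm_errKernel (ha : ∀ k, ‖a k‖ < 1) (n : ℕ) {z : ℂ} (hz : ‖z‖ < 1) :
    Real.circleAverage (fun w => ‖errKernel a n z w‖) 0 1 =
      (1 - ‖blaschke a n z‖ ^ 2) / (1 - ‖z‖ ^ 2) := by
  have hcl : closure (ball (0 : ℂ) 1) = closedBall 0 1 := closure_ball _ one_ne_zero
  set b := blaschke a n z
  have hP := circleIntegrable_poisson hz
  have hz2 : 1 - ‖z‖ ^ 2 ≠ 0 := by nlinarith [norm_nonneg z]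
  have hh : DiffContOnCl ℂ (fun w => conj b * blaschke a n w) (ball 0 1) :=
    (diffContOnCl_blaschke ha n).const_smul (conj b)
  have hmean := circleAverage_mul_poisson hh hz
  have hcont : ContinuousOn (fun w => conj b * blaschke a n w * ((1 / ‖w - z‖ ^ 2 : ℝ) : ℂ))
      (sphere 0 1) := by
    refine (hh.2.mono (by rw [hcl]; exact sphere_subset_closedBall)).mul
      (Complex.continuous_ofReal.comp_continuousOn
        (ContinuousOn.div (by fun_prop) (by fun_prop) fun w hw => ?_))
    exact pow_ne_zero 2 (norm_ne_zero_iff.2 (sub_ne_zero_of_norm hz (by simpa using hw)))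
  have hi := hcont.circleIntegrable zero_le_one
  have hre := Complex.reCLM.circleAverage_comp_comm hi
  have hire : CircleIntegrable (fun w => Complex.reCLM
      (conj b * blaschke a n w * ((1 / ‖w - z‖ ^ 2 : ℝ) : ℂ))) 0 1 :=
    (Complex.reCLM.continuous.comp_continuousOn hcont).circleIntegrable zero_le_one
  -- Since `|β| = 1`, `|1 - conj b β|² = 1 + |b|² - 2 Re(conj b β)`. Poisson's formula sends `conj b
  -- β` to `|b|²`, so the total is `1 + |b|² - 2|b|²`, divided by `1 - |z|²`.
  have e : Set.EqOn (fun w => ‖errKernel a n z w‖) (fun w => (1 + ‖b‖ ^ 2) • (1 / ‖w - z‖ ^ 2) -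
      (2 : ℝ) • Complex.reCLM (conj b * blaschke a n w * ((1 / ‖w - z‖ ^ 2 : ℝ) : ℂ)))
      (sphere 0 |1|) := by
    intro w hw
    have hw : ‖w‖ = 1 := by simpa using hw
    have h1 : ‖1 - conj b * blaschke a n w‖ ^ 2 =
        1 + ‖b‖ ^ 2 - 2 * (conj b * blaschke a n w).re := by
      have hn : ‖conj b * blaschke a n w‖ ^ 2 = ‖b‖ ^ 2 := by
        rw [norm_mul, RCLike.norm_conj, norm_blaschke_of_norm_one ha n hw, mul_one]
      rw [← hn, Complex.sq_norm, Complex.sq_norm, Complex.normSq_apply, Complex.normSq_apply]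
      simp only [Complex.sub_re, Complex.sub_im, Complex.one_re, Complex.one_im]
      ring
    simp only [norm_errKernel a n hw, smul_eq_mul, Complex.reCLM_apply, Complex.re_mul_ofReal]
    change ‖1 - conj b * blaschke a n w‖ ^ 2 * _ = _
    rw [h1]
    ring
  rw [Real.circleAverage_congr_sphere e, Real.circleAverage_fun_sub
    (hP.const_fun_smul (a := 1 + ‖b‖ ^ 2)) (hire.const_fun_smul (a := (2 : ℝ))),
    Real.circleAverage_fun_smul, Real.circleAverage_fun_smul, circleAverage_poisson hz]
  have hre' : Real.circleAverage (fun w => Complex.reCLM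
      (conj b * blaschke a n w * ((1 / ‖w - z‖ ^ 2 : ℝ) : ℂ))) 0 1 = ‖b‖ ^ 2 / (1 - ‖z‖ ^ 2) := by
    refine hre.trans ?_
    rw [hmean, mul_comm (conj b)]
    change ((b * conj b) / _ : ℂ).re = _
    rw [Complex.mul_conj', ← Complex.ofReal_pow, ← Complex.ofReal_div, Complex.ofReal_re]
  rw [hre']
  simp only [smul_eq_mul]
  field_simp
  ring

theorem norm_sub_sigmaPlus_le (ha : ∀ k, ‖a k‖ < 1) (hf : f ∈ schur) {n : ℕ} (hn : 1 ≤ n) {z : ℂ}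
    (hz : ‖z‖ < 1) (hd : deriv (blaschke a n) z ≠ 0) :
    ‖f z - sigmaPlus a n f z‖ ≤ ‖blaschke a n z / deriv (blaschke a n) z‖ *
      ((1 - ‖blaschke a n z‖ ^ 2) / (1 - ‖z‖ ^ 2)) + ‖blaschke a n z‖ ^ 2 := by
  have hI : ‖Real.circleAverage (fun w => withBoundary f w * errKernel a n z w) 0 1‖ ≤
      (1 - ‖blaschke a n z‖ ^ 2) / (1 - ‖z‖ ^ 2) := by
    rw [← circleAverage_norm_errKernel ha n hz]
    refine norm_circleAverage_le
      ((continuousOn_errKernel ha n hz).norm.circleIntegrable zero_le_one) ?_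
    filter_upwards [ae_norm_withBoundary_le hf] with θ hθ
    rw [norm_mul]
    exact mul_le_of_le_one_left (norm_nonneg _) hθ
  have hfz : ‖f z‖ ≤ 1 := hf.2 z (by simpa using hz)
  rw [sub_sigmaPlus_eq ha hf hn hz hd, mul_add]
  refine (norm_add_le _ _).trans (add_le_add ?_ ?_)
  · rw [norm_mul]
    gcongr
  · have : blaschke a n z / deriv (blaschke a n) z *
        (conj (blaschke a n z) * (f z * deriv (blaschke a n) z)) =
        blaschke a n z * conj (blaschke a n z) * f z := by field_simp
    rw [this, norm_mul, norm_mul, RCLike.norm_conj, ← sq]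
    exact mul_le_of_le_one_right (by positivity) hfz

lemma withBoundary_eq_of_continuousWithinAt {t : ℂ} (ht : ‖t‖ = 1)
    (hf : ContinuousWithinAt f (ball 0 1) t) : withBoundary f t = f t :=
  withBoundary_of_tendsto ht (hf.mono_left (nonTangential_le t))

/-- The Blaschke factor with zero `z`. -/
noncomputable def mobius (z w : ℂ) : ℂ := (w - z) / (1 - w * conj z)

lemma mobius_mem_schur {z : ℂ} (hz : ‖z‖ < 1) : mobius z ∈ schur := by
  refine ⟨fun w hw => ?_, fun w hw => ?_⟩
  · have hw' : ‖w‖ < 1 := by simpa using hw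
    have : DifferentiableAt ℂ (fun w => (w - z) / (1 - w * conj z)) w :=
      DifferentiableAt.div (by fun_prop) (by fun_prop) (one_sub_mul_conj_ne_zero hw'.le hz)
    exact this.differentiableWithinAt
  · have hw' : ‖w‖ < 1 := by simpa using hw
    have hpos : 0 < ‖1 - w * conj z‖ := norm_pos_iff.2 (one_sub_mul_conj_ne_zero hw'.le hz)
    rw [mobius, norm_div, div_le_one hpos]
    refine (sq_le_sq₀ (norm_nonneg _) hpos.le).1 ?_
    have e : ‖1 - w * conj z‖ ^ 2 - ‖w - z‖ ^ 2 = (1 - ‖w‖ ^ 2) * (1 - ‖z‖ ^ 2) := by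
      simp only [Complex.sq_norm, Complex.normSq_apply, Complex.sub_re, Complex.sub_im,
        Complex.mul_re, Complex.mul_im, Complex.conj_re, Complex.conj_im, Complex.one_re,
        Complex.one_im]
      ring
    have h1 : 0 ≤ 1 - ‖w‖ ^ 2 := by nlinarith [norm_nonneg w]
    have h2 : 0 ≤ 1 - ‖z‖ ^ 2 := by nlinarith [norm_nonneg z]
    nlinarith [mul_nonneg h1 h2]

/-- On the circle `mobius z w · w/(w - z)² = 1/|w - z|²`, so the integrand becomes the modulus of
`errKernel`; the zero at `z` removes the other term. -/
theorem norm_mobius_sub_sigmaPlus (ha : ∀ k, ‖a k‖ < 1) {n : ℕ} (hn : 1 ≤ n) {z : ℂ}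
    (hz : ‖z‖ < 1) (hd : deriv (blaschke a n) z ≠ 0) :
    ‖mobius z z - sigmaPlus a n (mobius z) z‖ = ‖blaschke a n z / deriv (blaschke a n) z‖ *
      ((1 - ‖blaschke a n z‖ ^ 2) / (1 - ‖z‖ ^ 2)) := by
  have h0 : mobius z z = 0 := by simp [mobius]
  rw [sub_sigmaPlus_eq ha (mobius_mem_schur hz) hn hz hd, h0, zero_mul, mul_zero, add_zero,
    norm_mul, ← circleAverage_norm_errKernel ha n hz]
  congr 1
  have e : Set.EqOn (fun w => withBoundary (mobius z) w * errKernel a n z w)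
      (fun w => ((‖errKernel a n z w‖ : ℝ) : ℂ)) (sphere 0 |1|) := by
    intro w hw
    have hw : ‖w‖ = 1 := by simpa using hw
    have hwz := sub_ne_zero_of_norm hz hw
    have hden := one_sub_mul_conj_ne_zero hw.le hz
    have hb : withBoundary (mobius z) w = mobius z w := by
      refine withBoundary_eq_of_continuousWithinAt hw (ContinuousAt.continuousWithinAt ?_)
      exact ContinuousAt.div (by fun_prop) (by fun_prop) hden
    have hn : ((‖w - z‖ : ℝ) : ℂ) ^ 2 = (w - z) * conj (w - z) := (Complex.mul_conj' _).symm
    have hn2 : ((‖1 - conj (blaschke a n z) * blaschke a n w‖ : ℝ) : ℂ) ^ 2 =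
        (1 - blaschke a n z * conj (blaschke a n w)) *
          (1 - conj (blaschke a n z) * blaschke a n w) := by
      rw [← Complex.mul_conj', mul_comm]; simp
    have hd : 1 - w * conj z = w * conj (w - z) := by
      rw [map_sub, mul_sub, mul_conj_of_norm_one hw]
    have hw0 : w ≠ 0 := left_ne_zero_of_mul_eq_one (mul_conj_of_norm_one hw)
    have hc : conj (w - z) ≠ 0 := (map_ne_zero _).2 hwz
    simp only [hb, norm_errKernel a n hw]
    push_cast
    rw [hn, hn2, mobius, errKernel, hd]
    generalize conj (w - z) = v at hc
    field_simp
  rw [Real.circleAverage_congr_sphere e, ← ofReal_circleAverage, Complex.norm_real,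
    Real.norm_of_nonneg]
  exact Real.circleAverage_nonneg_of_nonneg fun w _ => norm_nonneg _

/-! ### The bound 2 on the circle and in the disc -/

lemma analyticAt_blaschke (ha : ∀ k, ‖a k‖ < 1) (n : ℕ) {z : ℂ} (hz : ‖z‖ ≤ 1) :
    AnalyticAt ℂ (blaschke a n) z := by
  refine Finset.analyticAt_fun_prod _ fun k _ => ?_
  exact AnalyticAt.div (by fun_prop) (by fun_prop) (one_sub_mul_conj_ne_zero hz (ha k))

lemma analyticAt_phi (ha : ∀ k, ‖a k‖ < 1) (k : ℕ) {z : ℂ} (hz : ‖z‖ ≤ 1) :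
    AnalyticAt ℂ (phi a k) z :=
  AnalyticAt.mul (AnalyticAt.div (by fun_prop) (by fun_prop)
    (one_sub_mul_conj_ne_zero hz (ha k))) (analyticAt_blaschke ha k hz)

lemma analyticAt_partialSum (ha : ∀ k, ‖a k‖ < 1) (n : ℕ) {z : ℂ} (hz : ‖z‖ ≤ 1) :
    AnalyticAt ℂ (partialSum a n f) z :=
  Finset.analyticAt_fun_sum _ fun k _ => analyticAt_const.mul (analyticAt_phi ha k hz)

lemma continuousAt_sigmaPlus (ha : ∀ k, ‖a k‖ < 1) {n : ℕ} (hn : 1 ≤ n) {t : ℂ} (ht : ‖t‖ = 1) :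
    ContinuousAt (sigmaPlus a n f) t := by
  have hn0 : n ≠ 0 := by omega
  have e : sigmaPlus a n f = fun z => partialSum a n f z -
      blaschke a n z / deriv (blaschke a n) z * deriv (partialSum a n f) z := by
    funext z
    rw [sigmaPlus, if_neg hn0]
  rw [e]
  have hB := analyticAt_blaschke ha n ht.le
  have hS := analyticAt_partialSum (f := f) ha n ht.le
  exact hS.continuousAt.sub ((hB.continuousAt.div hB.deriv.continuousAt
    (deriv_blaschke_ne_zero ha hn ht)).mul hS.deriv.continuousAt)

/-- The upper bound for the error, in a form continuous up to the unit circle. -/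
noncomputable def errBound (a : ℕ → ℂ) (n : ℕ) (z : ℂ) : ℝ :=
  ‖blaschke a n z / deriv (blaschke a n) z‖ * energy a n z + ‖blaschke a n z‖ ^ 2

lemma continuousAt_errBound (ha : ∀ k, ‖a k‖ < 1) {n : ℕ} (hn : 1 ≤ n) {t : ℂ} (ht : ‖t‖ = 1) :
    ContinuousAt (errBound a n) t := by
  have hB := analyticAt_blaschke ha n ht.le
  have hE : ContinuousAt (energy a n) t :=
    tendsto_finsetSum _ fun k _ => ((analyticAt_phi ha k ht.le).continuousAt.norm.pow 2)
  exact ((hB.continuousAt.div hB.deriv.continuousAt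
    (deriv_blaschke_ne_zero ha hn ht)).norm.mul hE).add (hB.continuousAt.norm.pow 2)

lemma errBound_of_norm_one (ha : ∀ k, ‖a k‖ < 1) {n : ℕ} (hn : 1 ≤ n) {t : ℂ} (ht : ‖t‖ = 1) :
    errBound a n t = 2 := by
  have := energy_pos ha hn ht.le
  rw [errBound, norm_div, norm_blaschke_of_norm_one ha n ht, norm_deriv_blaschke_of_norm_one ha n ht]
  field_simp
  norm_num

lemma err_of_norm_lt {n : ℕ} {z : ℂ} (hz : ‖z‖ < 1) : err a n f z = f z - sigmaPlus a n f z := by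
  rw [err, withBoundary_of_norm_lt hz]

lemma norm_err_le_errBound (ha : ∀ k, ‖a k‖ < 1) (hf : f ∈ schur) {n : ℕ} (hn : 1 ≤ n) {z : ℂ}
    (hz : ‖z‖ < 1) (hd : deriv (blaschke a n) z ≠ 0) : ‖err a n f z‖ ≤ errBound a n z := by
  rw [err_of_norm_lt hz, errBound, ← energy_eq ha n hz]
  exact norm_sub_sigmaPlus_le ha hf hn hz hd

lemma eventually_nonTangential_norm_lt (t : ℂ) : ∀ᶠ z in nonTangential t, ‖z‖ < 1 :=
  nonTangential_le t (mem_of_superset self_mem_nhdsWithin fun z hz => by simpa using hz)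

lemma tendsto_err_nonTangential (ha : ∀ k, ‖a k‖ < 1) {n : ℕ} (hn : 1 ≤ n) {t L : ℂ}
    (ht : ‖t‖ = 1) (hL : Tendsto f (nonTangential t) (𝓝 L)) :
    Tendsto (err a n f) (nonTangential t) (𝓝 (err a n f t)) := by
  rw [err, withBoundary_of_tendsto ht hL]
  refine (hL.sub ((continuousAt_sigmaPlus (f := f) ha hn ht).tendsto.mono_left
    ((nonTangential_le t).trans nhdsWithin_le_nhds))).congr' ?_
  filter_upwards [eventually_nonTangential_norm_lt t] with z hz
  rw [err_of_norm_lt hz]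

lemma eventually_deriv_blaschke_ne_zero (ha : ∀ k, ‖a k‖ < 1) {n : ℕ} (hn : 1 ≤ n) {t : ℂ}
    (ht : ‖t‖ = 1) : ∀ᶠ z in 𝓝 t, deriv (blaschke a n) z ≠ 0 :=
  (analyticAt_blaschke ha n ht.le).deriv.continuousAt.eventually_ne
    (deriv_blaschke_ne_zero ha hn ht)

lemma norm_err_le_two (ha : ∀ k, ‖a k‖ < 1) (hf : f ∈ schur) {n : ℕ} (hn : 1 ≤ n) {t L : ℂ}
    (ht : ‖t‖ = 1) (hL : Tendsto f (nonTangential t) (𝓝 L)) : ‖err a n f t‖ ≤ 2 := by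
  have := nonTangential_neBot ht
  have hle : nonTangential t ≤ 𝓝 t := (nonTangential_le t).trans nhdsWithin_le_nhds
  have hV := (continuousAt_errBound ha hn ht).tendsto.mono_left hle
  rw [errBound_of_norm_one ha hn ht] at hV
  refine le_of_tendsto_of_tendsto (tendsto_err_nonTangential ha hn ht hL).norm hV ?_
  filter_upwards [eventually_nonTangential_norm_lt t,
    hle (eventually_deriv_blaschke_ne_zero ha hn ht)] with z hz hd
  exact norm_err_le_errBound ha hf hn hz hd

/-- Here the limit exists at every boundary point, which permits a true supremum over the circle. -/
lemma exists_tendsto_of_mem_discAlgebra (hf : f ∈ discAlgebra) {t : ℂ} (ht : ‖t‖ = 1) :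
    ∃ L, Tendsto f (nonTangential t) (𝓝 L) := by
  obtain ⟨-, g, hg, hfg⟩ := hf
  have h1 : Tendsto g (𝓝[ball 0 1] t) (𝓝 (g t)) :=
    (hg t (by simp [ht])).mono_left (nhdsWithin_mono _ ball_subset_closedBall)
  refine ⟨g t, (h1.congr' ?_).mono_left (nonTangential_le t)⟩
  filter_upwards [self_mem_nhdsWithin] with z hz using (hfg hz).symm

/-- If `B_n / B_n'` is holomorphic in the disc, the error is at most `2` there. -/
lemma norm_err_le_two_of_norm_lt (ha : ∀ k, ‖a k‖ < 1) (hf : f ∈ schur) {n : ℕ} (hn : 1 ≤ n)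
    {q : ℂ → ℂ} (hq : DifferentiableOn ℂ q (ball 0 1))
    (hqB : ∀ z ∈ ball (0 : ℂ) 1, deriv (blaschke a n) z ≠ 0 →
      q z = blaschke a n z / deriv (blaschke a n) z)
    {z : ℂ} (hz : ‖z‖ < 1) (hd : deriv (blaschke a n) z ≠ 0) : ‖err a n f z‖ ≤ 2 := by
  have hn0 : n ≠ 0 := by omega
  -- The holomorphic continuation of the error across the zeros of `B_n'`, to which the maximum
  -- principle applies.
  set h : ℂ → ℂ := fun z => f z - (partialSum a n f z - q z * deriv (partialSum a n f) z) with hh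
  have herr : ∀ z, ‖z‖ < 1 → deriv (blaschke a n) z ≠ 0 → err a n f z = h z := by
    intro z hz hd
    rw [err_of_norm_lt hz, sigmaPlus, if_neg hn0, hh, ← hqB z (by simpa using hz) hd]
  have hdiff : DifferentiableOn ℂ h (ball 0 1) := by
    have hS : ∀ z ∈ ball (0 : ℂ) 1, AnalyticAt ℂ (partialSum a n f) z := fun z hz =>
      analyticAt_partialSum ha n (by simpa using (ball_subset_closedBall hz))
    exact hf.1.sub (DifferentiableOn.sub
      (fun z hz => (hS z hz).differentiableAt.differentiableWithinAt)
      (hq.mul fun z hz => (hS z hz).deriv.differentiableAt.differentiableWithinAt))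
  refine le_of_forall_pos_le_add fun η hη => ?_
  set O : Set ℂ := {z | deriv (blaschke a n) z ≠ 0 ∧ errBound a n z < 2 + η}
  have hO : sphere (0 : ℂ) 1 ⊆ interior O := by
    intro t ht
    have ht : ‖t‖ = 1 := by simpa using ht
    refine mem_interior_iff_mem_nhds.2 ?_
    refine (eventually_deriv_blaschke_ne_zero ha hn ht).and
      ((continuousAt_errBound ha hn ht).eventually (gt_mem_nhds ?_))
    rw [errBound_of_norm_one ha hn ht]
    linarith
  obtain ⟨δ, hδ, hthick⟩ := (isCompact_sphere (0 : ℂ) 1).exists_thickening_subset_open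
    isOpen_interior hO
  -- The circle of radius `r` encloses `z` and stays within `δ` of the unit circle, where `B_n' ≠ 0`
  -- and the bound is below `2 + η`.
  set r := max (1 - δ / 2) ((1 + ‖z‖) / 2)
  have hzr : ‖z‖ < r := lt_of_lt_of_le (by linarith) (le_max_right _ _)
  have hr0 : 0 < r := (norm_nonneg z).trans_lt hzr
  have hr1 : r < 1 := max_lt (by linarith) (by linarith)
  rw [herr z hz hd]
  refine Complex.norm_le_of_forall_mem_frontier_norm_le (U := ball 0 r) isBounded_ball
    (DifferentiableOn.diffContOnCl ?_) (fun w hw => ?_) (subset_closure (by simpa using hzr))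
  · rw [closure_ball _ hr0.ne']
    exact hdiff.mono (closedBall_subset_ball hr1)
  · have hwr : ‖w‖ = r := by simpa [frontier_ball _ hr0.ne'] using hw
    have hwO : w ∈ O := by
      refine interior_subset (hthick (mem_thickening_iff.2 ⟨w / (r : ℂ), ?_, ?_⟩))
      · simp [hwr, abs_of_pos hr0, hr0.ne']
      · have hrc : (r : ℂ) ≠ 0 := by exact_mod_cast hr0.ne'
        have e : w - w / (r : ℂ) = w / (r : ℂ) * ((r - 1 : ℝ) : ℂ) := by
          push_cast; field_simp
        rw [dist_eq_norm, e, norm_mul, norm_div, hwr, Complex.norm_real, Complex.norm_real,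
          Real.norm_of_nonneg hr0.le, div_self hr0.ne', one_mul, Real.norm_of_nonpos (by linarith)]
        have : 1 - δ / 2 ≤ r := le_max_left _ _
        linarith
    have hw1 : ‖w‖ < 1 := by rw [hwr]; exact hr1
    rw [← herr w hw1 hwO.1]
    exact (norm_err_le_errBound ha hf hn hw1 hwO.1).trans hwO.2.le

/-! ### The peaking family -/

/-- A Schur function that equals `1` at `-1` and is close to `-1` away from that point when `r` is
close to `1`. -/
noncomputable def peak (r : ℝ) (s : ℂ) : ℂ := -1 + 2 * (1 - r) / (1 + s * r)

lemma one_add_mul_ne_zero {r : ℝ} (h0 : 0 < r) (h1 : r < 1) {s : ℂ} (hs : ‖s‖ ≤ 1) :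
    1 + s * (r : ℂ) ≠ 0 := by
  have := one_sub_mul_conj_ne_zero (w := ((-r : ℝ) : ℂ)) hs
    (by rw [Complex.norm_real, norm_neg, Real.norm_of_nonneg h0.le]; exact h1)
  rw [Complex.conj_ofReal] at this
  simpa using this

lemma differentiableAt_peak {r : ℝ} (h0 : 0 < r) (h1 : r < 1) {s : ℂ} (hs : ‖s‖ ≤ 1) :
    DifferentiableAt ℂ (peak r) s :=
  DifferentiableAt.add (by fun_prop)
    (DifferentiableAt.div (by fun_prop) (by fun_prop) (one_add_mul_ne_zero h0 h1 hs))

lemma peak_mem {r : ℝ} (h0 : 0 < r) (h1 : r < 1) : peak r ∈ schur ∩ discAlgebra := by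
  have hd : DifferentiableOn ℂ (peak r) (closedBall 0 1) := fun s hs =>
    (differentiableAt_peak h0 h1 (by simpa using hs)).differentiableWithinAt
  have hdb := hd.mono ball_subset_closedBall
  refine ⟨⟨hdb, fun s hs => ?_⟩, hdb, peak r, hd.continuousOn, fun _ _ => rfl⟩
  have hs : ‖s‖ < 1 := by simpa using hs
  have hne := one_add_mul_ne_zero h0 h1 hs.le
  -- With `x = 1 + s r`, the inequality `|2(1 - r) - x| ≤ |x|` amounts to `Re x ≥ 1 - r`, which
  -- follows from `Re s ≥ -1`.
  have e : peak r s = ((2 * (1 - r) : ℝ) - (1 + s * r)) / (1 + s * r) := by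
    rw [peak, eq_div_iff hne, add_mul, div_mul_cancel₀ _ hne]; push_cast; ring
  have hpos := norm_pos_iff.2 hne
  rw [e, norm_div, div_le_one hpos]
  refine (sq_le_sq₀ (norm_nonneg _) hpos.le).1 ?_
  have hre : -1 ≤ s.re := by
    have := Complex.abs_re_le_norm s
    linarith [neg_abs_le s.re]
  rw [Complex.sq_norm, Complex.sq_norm, Complex.normSq_apply, Complex.normSq_apply]
  simp only [Complex.sub_re, Complex.sub_im, Complex.add_re, Complex.add_im, Complex.one_re,
    Complex.one_im, Complex.re_mul_ofReal, Complex.im_mul_ofReal, Complex.ofReal_re,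
    Complex.ofReal_im]
  nlinarith [mul_nonneg (sub_nonneg.2 h1.le) (mul_nonneg h0.le (by linarith : 0 ≤ 1 + s.re)),
    mul_nonneg (sub_nonneg.2 h1.le) (mul_nonneg h0.le (by linarith : 0 ≤ 1 + s.re))]

lemma withBoundary_peak {r : ℝ} (h0 : 0 < r) (h1 : r < 1) {s : ℂ} (hs : ‖s‖ = 1) :
    withBoundary (peak r) s = peak r s :=
  withBoundary_eq_of_continuousWithinAt hs
    (differentiableAt_peak h0 h1 hs.le).continuousAt.continuousWithinAt

/-- On the circle the conjugate of `peak r` is `-1 + 2(1 - r) s/(s + r)`, so the conjugate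
coefficient is given by Cauchy's formula for `phi a k` at `0` and at `-r`. -/
lemma coeff_peak (ha : ∀ k, ‖a k‖ < 1) {r : ℝ} (h0 : 0 < r) (h1 : r < 1) (k : ℕ) :
    coeff a (peak r) k = -conj (phi a k 0) + 2 * (1 - r) * conj (phi a k (-r)) := by
  have hcl : closure (ball (0 : ℂ) 1) = closedBall 0 1 := closure_ball _ one_ne_zero
  have hr : ‖(-r : ℂ)‖ < 1 := by simpa [abs_of_pos h0] using h1
  have hphi : DiffContOnCl ℂ (phi a k) (ball 0 |1|) := by
    rw [abs_one]
    refine ⟨fun z hz => (differentiableAt_phi ha k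
      (by simpa using (ball_subset_closedBall hz))).differentiableWithinAt, ?_⟩
    rw [hcl]
    exact continuousOn_phi ha k
  have e0 := hphi.circleAverage
  have e1 := hphi.circleAverage_smul_div (w := (-r : ℂ)) (by simpa using hr)
  have c0 : ContinuousOn (phi a k) (sphere 0 1) :=
    (continuousOn_phi ha k).mono sphere_subset_closedBall
  have c1 : ContinuousOn (fun s => ((s - 0) / (s - (-r : ℂ))) • phi a k s) (sphere 0 1) :=
    ContinuousOn.smul (ContinuousOn.div (by fun_prop) (by fun_prop) fun s hs =>
      sub_ne_zero_of_norm hr (by simpa using hs)) c0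
  have c2 := (c1.const_smul (2 * (1 - r) : ℂ)).sub c0
  have e2 : Real.circleAverage (fun s => (2 * (1 - r) : ℂ) •
      (((s - 0) / (s - (-r : ℂ))) • phi a k s) - phi a k s) 0 1 =
      2 * (1 - r) * phi a k (-r) - phi a k 0 := by
    have c3 : CircleIntegrable (fun s => (2 * (1 - r) : ℂ) •
        (((s - 0) / (s - (-r : ℂ))) • phi a k s)) 0 1 :=
      (c1.const_smul (2 * (1 - r) : ℂ)).circleIntegrable zero_le_one
    rw [Real.circleAverage_fun_sub c3
      (c0.circleIntegrable zero_le_one), Real.circleAverage_fun_smul, e1, e0, smul_eq_mul]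
  have e3 := Complex.conjCLE.toContinuousLinearMap.circleAverage_comp_comm
    (c2.circleIntegrable zero_le_one)
  rw [coeff, Real.circleAverage_congr_sphere
    (f₂ := fun s => conj ((2 * (1 - r) : ℂ) •
      (((s - 0) / (s - (-r : ℂ))) • phi a k s) - phi a k s))]
  · refine e3.trans ?_
    refine (congrArg _ e2).trans ?_
    change conj _ = _
    simp only [map_sub, map_mul, map_ofNat, map_one, Complex.conj_ofReal]
    ring
  · intro s hs
    have hs : ‖s‖ = 1 := by simpa using hs
    have hs1 := mul_conj_of_norm_one hs
    have hs0 : s ≠ 0 := left_ne_zero_of_mul_eq_one hs1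
    have hcs : conj s = 1 / s := by rw [eq_div_iff hs0, mul_comm, hs1]
    have hne := one_add_mul_ne_zero h0 h1 hs.le
    have hne' : 1 + (r : ℂ) * s ≠ 0 := by rwa [mul_comm]
    simp only [withBoundary_peak h0 h1 hs, smul_eq_mul, map_sub, map_mul, map_div₀,
      map_add, map_ofNat, map_one, Complex.conj_ofReal, hcs, peak, sub_zero, sub_neg_eq_add]
    have : 1 / s + (r : ℂ) = (1 + s * r) / s := by field_simp
    rw [this]
    field_simp
    ring

lemma tendsto_err_peak (ha : ∀ k, ‖a k‖ < 1) {n : ℕ} (hn : 1 ≤ n) :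
    Tendsto (fun r : ℝ => err a n (peak r) (-1)) (𝓝[<] 1) (𝓝 2) := by
  have hn0 : n ≠ 0 := by omega
  have ht : ‖(-1 : ℂ)‖ = 1 := by simp
  have hB' := deriv_blaschke_ne_zero ha hn ht
  set c := blaschke a n (-1) / deriv (blaschke a n) (-1) with hc
  have hev : ∀ᶠ r : ℝ in 𝓝[<] 1, 0 < r := nhdsWithin_le_nhds (lt_mem_nhds one_pos)
  have hcoeff : ∀ k, Tendsto (fun r : ℝ => -conj (phi a k 0) +
      2 * (1 - (r : ℂ)) * conj (phi a k (-r))) (𝓝[<] 1) (𝓝 (-conj (phi a k 0))) := by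
    intro k
    have h1 : ContinuousAt (fun r : ℝ => -conj (phi a k 0) +
        2 * (1 - (r : ℂ)) * conj (phi a k (-r))) 1 := by
      have hp : ContinuousAt (fun r : ℝ => phi a k (-(r : ℂ))) 1 :=
        ContinuousAt.comp (g := phi a k)
          (differentiableAt_phi ha k (by simp)).continuousAt (by fun_prop)
      exact continuousAt_const.add (ContinuousAt.mul (by fun_prop)
        (Complex.continuous_conj.continuousAt.comp hp))
    have := h1.tendsto.mono_left (nhdsWithin_le_nhds (s := Set.Iio 1))
    simpa using this
  have hlim : Tendsto (fun r : ℝ => 1 - ∑ k ∈ Finset.range n, (-conj (phi a k 0) +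
      2 * (1 - (r : ℂ)) * conj (phi a k (-r))) * (phi a k (-1) - c * deriv (phi a k) (-1)))
      (𝓝[<] 1) (𝓝 (1 - ∑ k ∈ Finset.range n, (-conj (phi a k 0)) *
        (phi a k (-1) - c * deriv (phi a k) (-1)))) :=
    tendsto_const_nhds.sub (tendsto_finsetSum _ fun k _ => (hcoeff k).mul_const _)
  -- This is `σ⁺` of the constant `-1`, evaluated at `-1`. In both Christoffel–Darboux formulas with
  -- `w = 0`, the terms containing `conj B_n(0)` cancel.
  have hval : ∑ k ∈ Finset.range n, (-conj (phi a k 0)) *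
        (phi a k (-1) - c * deriv (phi a k) (-1)) = -1 := by
    have h1 := christoffel_darboux' ha n ht.le (w := 0) (by simp)
    have h2 := christoffel_darboux_deriv ha n ht.le (w := 0) (by simp)
    simp only [map_zero, mul_zero, sub_zero, one_mul, zero_mul] at h1 h2
    have h3 : ∑ k ∈ Finset.range n, (-conj (phi a k 0)) *
        (phi a k (-1) - c * deriv (phi a k) (-1)) =
        -kernel a n (-1) 0 + c * kernelDeriv a n (-1) 0 := by
      rw [kernel, kernelDeriv, Finset.mul_sum, ← Finset.sum_neg_distrib, ← Finset.sum_add_distrib]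
      exact Finset.sum_congr rfl fun k _ => by ring
    rw [h3, h1, h2, hc]
    field_simp
    ring
  rw [hval] at hlim
  have h2 : (1 : ℂ) - -1 = 2 := by norm_num
  rw [h2] at hlim
  refine hlim.congr' ?_
  filter_upwards [hev, self_mem_nhdsWithin] with r hr0 hr1
  have hr1 : r < 1 := hr1
  have hp : peak r (-1) = 1 := by
    have hne : (1 : ℂ) - r ≠ 0 := sub_ne_zero.2 (by exact_mod_cast hr1.ne')
    have : (1 : ℂ) + (-1) * r = 1 - r := by ring
    rw [peak, this]
    field_simp
    norm_num
  rw [err, withBoundary_peak hr0 hr1 ht, hp, sigmaPlus, if_neg hn0, deriv_partialSum ha n ht.le,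
    partialSum, ← hc, Finset.mul_sum, ← Finset.sum_sub_distrib]
  congr 1
  refine Finset.sum_congr rfl fun k _ => ?_
  rw [coeff_peak ha hr0 hr1]
  ring

/-! ### Passage to suprema -/

lemma enorm_two : ‖(2 : ℂ)‖ₑ = 2 := by
  rw [← ofReal_norm]; simp

/-- Lower bounds for all functions of the peaking family give lower bounds for suprema. -/
lemma two_le_of_forall_peak (ha : ∀ k, ‖a k‖ < 1) {n : ℕ} (hn : 1 ≤ n) {C : ℝ≥0∞}
    (h : ∀ r : ℝ, 0 < r → r < 1 → ‖err a n (peak r) (-1)‖ₑ ≤ C) : 2 ≤ C := by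
  rw [← enorm_two]
  refine le_of_tendsto (tendsto_err_peak ha hn).enorm ?_
  have hev : ∀ᶠ r : ℝ in 𝓝[<] 1, 0 < r := nhdsWithin_le_nhds (lt_mem_nhds one_pos)
  filter_upwards [hev, self_mem_nhdsWithin] with r h0 h1 using h r h0 h1

lemma enorm_le_two {w : ℂ} (h : ‖w‖ ≤ 2) : ‖w‖ₑ ≤ 2 := by
  rw [← ofReal_norm]
  exact ENNReal.ofReal_le_of_le_toReal (by simpa using h)

lemma circleEssSup_err_le (ha : ∀ k, ‖a k‖ < 1) (hf : f ∈ schur) {n : ℕ} (hn : 1 ≤ n) :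
    circleEssSup (err a n f) ≤ 2 := by
  rw [circleEssSup, MeasureTheory.eLpNorm_exponent_top]
  refine essSup_le_of_ae_le _ (MeasureTheory.ae_restrict_of_ae ?_)
  filter_upwards [ae_exists_tendsto_nonTangential hf] with θ ⟨L, hL⟩
  exact enorm_le_two (norm_err_le_two ha hf hn (by simp) hL)

lemma enorm_err_peak_le_circleEssSup (ha : ∀ k, ‖a k‖ < 1) {n : ℕ} (hn : 1 ≤ n) {r : ℝ}
    (h0 : 0 < r) (h1 : r < 1) :
    ‖err a n (peak r) (-1)‖ₑ ≤ circleEssSup (err a n (peak r)) := by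
  have hπ : circleMap 0 1 Real.pi = -1 := by simp [circleMap]
  have hcont : ContinuousAt (fun θ : ℝ => ‖err a n (peak r) (circleMap 0 1 θ)‖ₑ) Real.pi := by
    have e : (fun θ : ℝ => err a n (peak r) (circleMap 0 1 θ)) =
        fun θ => peak r (circleMap 0 1 θ) - sigmaPlus a n (peak r) (circleMap 0 1 θ) := by
      funext θ
      rw [err, withBoundary_peak h0 h1 (by simp)]
    refine ContinuousAt.enorm ?_
    rw [e]
    have hm : ContinuousAt (circleMap 0 1) Real.pi := (continuous_circleMap 0 1).continuousAt
    exact (ContinuousAt.comp (differentiableAt_peak h0 h1 (by simp)).continuousAt hm).sub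
      (ContinuousAt.comp (continuousAt_sigmaPlus ha hn (by simp)) hm)
  by_contra! hlt
  rw [← hπ] at hlt
  -- The point `-1` corresponds to `θ = π`, interior to the parameter interval; by continuity an
  -- excess there would persist on a set of positive measure.
  have hU : {θ : ℝ | circleEssSup (err a n (peak r)) < ‖err a n (peak r) (circleMap 0 1 θ)‖ₑ} ∩
      Set.Ioc 0 (2 * Real.pi) ∈ 𝓝 Real.pi :=
    inter_mem (hcont.eventually (lt_mem_nhds hlt))
      (Ioc_mem_nhds Real.pi_pos (by linarith [Real.pi_pos]))
  have hpos := MeasureTheory.Measure.measure_pos_of_mem_nhds MeasureTheory.volume hU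
  have hae := MeasureTheory.ae_le_eLpNormEssSup (f := fun θ : ℝ => err a n (peak r) (circleMap 0 1 θ))
    (μ := MeasureTheory.volume.restrict (Set.Ioc 0 (2 * Real.pi)))
  rw [MeasureTheory.ae_restrict_iff' measurableSet_Ioc, MeasureTheory.ae_iff] at hae
  refine hpos.ne' (MeasureTheory.measure_mono_null (fun θ hθ => ?_) hae)
  simp only [Set.mem_ofPred_eq, Classical.not_imp, not_le]
  exact ⟨hθ.2, by
    have := hθ.1
    rwa [Set.mem_ofPred_eq, circleEssSup, MeasureTheory.eLpNorm_exponent_top] at this⟩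

lemma enorm_err_peak_le_supOn_ball (ha : ∀ k, ‖a k‖ < 1) {n : ℕ} (hn : 1 ≤ n) {r : ℝ}
    (h0 : 0 < r) (h1 : r < 1) :
    ‖err a n (peak r) (-1)‖ₑ ≤
      supOn {z ∈ ball (0 : ℂ) 1 | deriv (blaschke a n) z ≠ 0} (err a n (peak r)) := by
  have ht : ‖(-1 : ℂ)‖ = 1 := by simp
  have := nonTangential_neBot ht
  obtain ⟨L, hL⟩ := exists_tendsto_of_mem_discAlgebra (peak_mem h0 h1).2 ht
  refine le_of_tendsto (tendsto_err_nonTangential ha hn ht hL).enorm ?_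
  filter_upwards [eventually_nonTangential_norm_lt (-1),
    ((nonTangential_le (-1)).trans nhdsWithin_le_nhds)
      (eventually_deriv_blaschke_ne_zero ha hn ht)] with z hz hd
  exact le_iSup₂_of_le z ⟨by simpa using hz, hd⟩ le_rfl

end TakenakaMalmquist

end

theorem mainTheorem3 (a : ℕ → ℂ) (ha : ∀ k, ‖a k‖ < 1) (n : ℕ) (hn : 1 ≤ n) :
    -- the pointwise two-sided estimate
    (∀ z : ℂ, ‖z‖ < 1 → deriv (TakenakaMalmquist.blaschke a n) z ≠ 0 →
      ENNReal.ofReal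
          (‖TakenakaMalmquist.blaschke a n z / deriv (TakenakaMalmquist.blaschke a n) z‖
            * ((1 - ‖TakenakaMalmquist.blaschke a n z‖ ^ 2) / (1 - ‖z‖ ^ 2)))
        ≤ (⨆ f ∈ TakenakaMalmquist.schur, ‖f z - TakenakaMalmquist.sigmaPlus a n f z‖ₑ) ∧
      (⨆ f ∈ TakenakaMalmquist.schur, ‖f z - TakenakaMalmquist.sigmaPlus a n f z‖ₑ)
        ≤ ENNReal.ofReal
          (‖TakenakaMalmquist.blaschke a n z / deriv (TakenakaMalmquist.blaschke a n) z‖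
            * ((1 - ‖TakenakaMalmquist.blaschke a n z‖ ^ 2) / (1 - ‖z‖ ^ 2))
            + ‖TakenakaMalmquist.blaschke a n z‖ ^ 2)) ∧
    -- the norms, taken on the unit circle
    ((⨆ f ∈ TakenakaMalmquist.schur,
        TakenakaMalmquist.circleEssSup (TakenakaMalmquist.err a n f)) = 2) ∧
    ((⨆ f ∈ TakenakaMalmquist.schur ∩ TakenakaMalmquist.discAlgebra,
        TakenakaMalmquist.supOn (Metric.sphere 0 1) (TakenakaMalmquist.err a n f)) = 2) ∧
    -- if `B_n / B_n'` is holomorphic in the disc, the norms taken in the disc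
    ((∃ q : ℂ → ℂ, DifferentiableOn ℂ q (Metric.ball 0 1) ∧
        ∀ z ∈ Metric.ball (0 : ℂ) 1, deriv (TakenakaMalmquist.blaschke a n) z ≠ 0 →
          q z = TakenakaMalmquist.blaschke a n z / deriv (TakenakaMalmquist.blaschke a n) z) →
      ((⨆ f ∈ TakenakaMalmquist.schur,
        TakenakaMalmquist.supOn
          {z ∈ Metric.ball (0 : ℂ) 1 | deriv (TakenakaMalmquist.blaschke a n) z ≠ 0}
          (TakenakaMalmquist.err a n f)) = 2) ∧
      ((⨆ f ∈ TakenakaMalmquist.schur ∩ TakenakaMalmquist.discAlgebra,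
        TakenakaMalmquist.supOn
          {z ∈ Metric.closedBall (0 : ℂ) 1 | deriv (TakenakaMalmquist.blaschke a n) z ≠ 0}
          (TakenakaMalmquist.err a n f)) = 2)) := by
  open TakenakaMalmquist in
  refine ⟨fun z hz hd => ⟨?_, ?_⟩, ?_, ?_, fun ⟨q, hq, hqB⟩ => ⟨?_, ?_⟩⟩
  · refine le_iSup₂_of_le (mobius z) (mobius_mem_schur hz) ?_
    rw [← norm_mobius_sub_sigmaPlus ha hn hz hd, ofReal_norm]
  · refine iSup₂_le fun f hf => ?_
    rw [← ofReal_norm]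
    exact ENNReal.ofReal_le_ofReal (norm_sub_sigmaPlus_le ha hf hn hz hd)
  · refine le_antisymm (iSup₂_le fun f hf => circleEssSup_err_le ha hf hn)
      (two_le_of_forall_peak ha hn fun r h0 h1 => ?_)
    exact le_iSup₂_of_le (peak r) (peak_mem h0 h1).1 (enorm_err_peak_le_circleEssSup ha hn h0 h1)
  · refine le_antisymm (iSup₂_le fun f hf => iSup₂_le fun t ht => ?_)
      (two_le_of_forall_peak ha hn fun r h0 h1 => ?_)
    · have ht : ‖t‖ = 1 := by simpa using ht
      obtain ⟨L, hL⟩ := exists_tendsto_of_mem_discAlgebra hf.2 ht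
      exact enorm_le_two (norm_err_le_two ha hf.1 hn ht hL)
    · exact le_iSup₂_of_le (peak r) (peak_mem h0 h1) (le_iSup₂_of_le (-1) (by simp) le_rfl)
  · refine le_antisymm (iSup₂_le fun f hf => iSup₂_le fun z hz => ?_)
      (two_le_of_forall_peak ha hn fun r h0 h1 => ?_)
    · exact enorm_le_two
        (norm_err_le_two_of_norm_lt ha hf hn hq hqB (by simpa using hz.1) hz.2)
    · exact le_iSup₂_of_le (peak r) (peak_mem h0 h1).1 (enorm_err_peak_le_supOn_ball ha hn h0 h1)
  · refine le_antisymm (iSup₂_le fun f hf => iSup₂_le fun z hz => ?_)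
      (two_le_of_forall_peak ha hn fun r h0 h1 => ?_)
    · have hz1 : ‖z‖ ≤ 1 := by simpa using hz.1
      rcases hz1.lt_or_eq with hlt | heq
      · exact enorm_le_two (norm_err_le_two_of_norm_lt ha hf.1 hn hq hqB hlt hz.2)
      · obtain ⟨L, hL⟩ := exists_tendsto_of_mem_discAlgebra hf.2 heq
        exact enorm_le_two (norm_err_le_two ha hf.1 hn heq hL)
    · exact le_iSup₂_of_le (peak r) (peak_mem h0 h1)
        (le_iSup₂_of_le (-1) ⟨by simp, deriv_blaschke_ne_zero ha hn (by simp)⟩ le_rfl)
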